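/- Let $k>2$ be an even integer and let $D>0$ be a discriminant, i.e. an integer with $D\equiv 0,1 \pmod 4$. Write $z=x+iy\in\mathbb H$, $q=e^{2\pi i z}$, let $\mathcal Q_D$ be the set of forms $Q(X,Y)=aX^2+bXY+cY^2$ with $a,b,c\in\mathbb Z$ and $b^2-4ac=D$, and put $$Q_z=\frac{a|z|^2+bx+c}{y},\qquad Q'(z,1)=\frac{d}{dz}Q(z,1),\qquad f_{k,D}(z)=\sum_{Q\in\mathcal Q_D}\frac1{Q(z,1)^k},\qquad \omega_{k+1,D}(z)=\sum_{Q\in\mathcal Q_D}\frac{Q_z}{Q(z,1)^{k+1}} .$$ These two series, and the series in (ii), converge absolutely for every $z\in\mathbb H$. (i) The function $\omega_{k+1,D}$ is a weak Maaß form of weight $2k+2$ for $\mathrm{SL}_2(\mathbb Z)$ with eigenvalue $2k$: it is smooth on $\mathbb H$, satisfies $\omega_{k+1,D}(\gamma z)=(cz+d)^{2k+2}\omega_{k+1,D}(z)$ for all $\gamma=\begin{pmatrix}a&b\\c&d\end{pmatrix}\in\mathrm{SL}_2(\mathbb Z)$, is of at most linear exponential growth towards all cusps, and satisfies $\Delta_{2k+2}\,\omega_{k+1,D}=2k\,\omega_{k+1,D}$,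 where $$\Delta_\kappa=-y^2\Big(\frac{\partial^2}{\partial x^2}+\frac{\partial^2}{\partial y^2}\Big)+i\kappa y\Big(\frac{\partial}{\partial x}+i\frac{\partial}{\partial y}\Big).$$ Moreover $\omega_{k+1,D}(z)\to0$ as $z\to i\infty$ (that is, as $y\to\infty$, uniformly in $x$). (ii) For all $z\in\mathbb H$, $$\omega_{k+1,D}(z)=-i\sum_{Q\in\mathcal Q_D}\frac{Q'(z,1)}{Q(z,1)^{k+1}}+\frac1y f_{k,D}(z).$$ The first summand is holomorphic on $\mathbb H$; the second is not holomorphic unless $f_{k,D}$ vanishes identically. (iii) Suppose that $f_{k,D}$ does not vanish identically, and let $c_{f_{k,D}}\neq0$ be the first non-vanishing coefficient of its Fourier expansion about $i\infty$. For $n\ge0$ let $j_n$ be the unique modular function for $\mathrm{SL}_2(\mathbb Z)$, holomorphic on $\mathbb H$, with Fourier expansion $q^{-n}+O(q)$. For $z\in\mathbb H$ let $H_z(\tau)$ be the meromorphic function of $\tau\in\mathbb H$ that equals $\sum_{n\ge0}j_n(z)e^{2\pi i n\tau}$ when $\operatorname{Im}\tau$ is sufficiently large. For a meromorphic modular form $f\not\equiv0$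 let $$f^{\mathrm{div}}(\tau)=\sum_{z\in\mathrm{SL}_2(\mathbb Z)\backslash\mathbb H}\frac{2}{|\mathrm{Stab}_z(\mathrm{SL}_2(\mathbb Z))|}\,\mathrm{ord}_z(f)\,H_z(\tau)$$ be its divisor modular form. Let $E_2(z)=1-24\sum_{n\ge1}\sum_{d\mid n}d\,q^n$ and $E_2^*(z)=E_2(z)-\frac{3}{\pi y}$. Then, for every $z\in\mathbb H$ with $f_{k,D}(z)\ne0$, $$\Big(\frac{1}{c_{f_{k,D}}}f_{k,D}\Big)^{\mathrm{div}}(z)=f_{k,D}^{\mathrm{div}}(z)=\frac{k}{2\pi}\,\frac{\omega_{k+1,D}(z)}{f_{k,D}(z)}+\frac k6E_2^*(z).$$ -/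

import Mathlib

open Complex Filter Topology Asymptotics
open UpperHalfPlane hiding I
open scoped MatrixGroups ModularForm Manifold ContDiff

noncomputable section

namespace ZagierForms

/-- An integral binary quadratic form `Q(X, Y) = a X² + b X Y + c Y²`. -/
@[ext]
structure IntQuadForm where
  a : ℤ
  b : ℤ
  c : ℤ

namespace IntQuadForm

/-- The discriminant `b² - 4ac`. -/
def disc (Q : IntQuadForm) : ℤ := Q.b ^ 2 - 4 * Q.a * Q.c

/-- The value `Q(X, Y)` at complex arguments. -/
def eval (Q : IntQuadForm) (X Y : ℂ) : ℂ :=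
  (Q.a : ℂ) * X ^ 2 + (Q.b : ℂ) * X * Y + (Q.c : ℂ) * Y ^ 2

/-- The derivative `Q'(z, 1) = d/dz Q(z, 1)`. -/
def evalDeriv (Q : IntQuadForm) (z : ℂ) : ℂ := deriv (fun w : ℂ => Q.eval w 1) z

/-- The real number `Q_z = (a |z|² + b x + c) / y` for `z = x + i y` in the upper half-plane. -/
def geo (Q : IntQuadForm) (z : ℍ) : ℝ :=
  ((Q.a : ℝ) * ‖(z : ℂ)‖ ^ 2 + (Q.b : ℝ) * z.re + (Q.c : ℝ)) / z.im

end IntQuadForm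

/-- The set `𝒬_D` of integral binary quadratic forms of discriminant `D`. -/
def QD (D : ℤ) : Set IntQuadForm := {Q | Q.disc = D}

/-- Zagier's function `f_{k,D}(z) = ∑_{Q ∈ 𝒬_D} Q(z,1)^{-k}`. -/
def fkD (k : ℕ) (D : ℤ) (z : ℍ) : ℂ := ∑' Q : QD D, 1 / (Q : IntQuadForm).eval z 1 ^ k

/-- The function `ω_{m,D}(z) = ∑_{Q ∈ 𝒬_D} Q_z / Q(z,1)^m`. -/
def omega (m : ℕ) (D : ℤ) (z : ℍ) : ℂ :=
  ∑' Q : QD D, ((Q : IntQuadForm).geo z : ℂ) / (Q : IntQuadForm).eval z 1 ^ m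

/-! ### Weak Maass forms for `SL₂(ℤ)` -/

/-- The partial derivative `∂F/∂x` of a function of `z = x + i y`. -/
def dx (F : ℂ → ℂ) (z : ℂ) : ℂ := fderiv ℝ F z 1

/-- The partial derivative `∂F/∂y` of a function of `z = x + i y`. -/
def dy (F : ℂ → ℂ) (z : ℂ) : ℂ := fderiv ℝ F z I

/-- The weight `κ` hyperbolic Laplace operator
`Δ_κ = -y² (∂²/∂x² + ∂²/∂y²) + i κ y (∂/∂x + i ∂/∂y)`. Functions on `ℍ` are differentiated
through `f ∘ ofComplex : ℂ → ℂ`, which is `f` on the open upper half-plane. -/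
def hypLaplacian (κ : ℤ) (f : ℍ → ℂ) (z : ℍ) : ℂ :=
  -(z.im : ℂ) ^ 2 * (dx (dx (f ∘ ofComplex)) z + dy (dy (f ∘ ofComplex)) z)
    + I * (κ : ℂ) * (z.im : ℂ) * (dx (f ∘ ofComplex) z + I * dy (f ∘ ofComplex) z)

/-- `f` is a weak Maass form of (integral) weight `κ` and eigenvalue `ev` for `SL₂(ℤ)`. -/
structure IsWeakMaassForm (κ : ℤ) (ev : ℂ) (f : ℍ → ℂ) : Prop where
  smooth : ContDiffOn ℝ ∞ (f ∘ ofComplex) upperHalfPlaneSet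
  slash_eq : ∀ γ : SL(2, ℤ), f ∣[κ] γ = f
  eigen : ∀ z : ℍ, hypLaplacian κ f z = ev * f z
  /-- At most linear exponential growth towards every cusp `γ(i∞)`. -/
  growth : ∀ γ : SL(2, ℤ), ∃ C : ℝ, (f ∣[κ] γ) =O[atImInfty] fun z : ℍ => Real.exp (C * z.im)

/-! ### Divisor modular forms -/

/-- `q = e^{2πiz}`. -/
def nome (z : ℍ) : ℂ := Complex.exp (2 * Real.pi * I * z)

/-- `F` is a modular function for `SL₂(ℤ)`, holomorphic on `ℍ`, with Fourier expansion of the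
form `q^{-n} + O(q)`. -/
structure IsJ (n : ℕ) (F : ℍ → ℂ) : Prop where
  slash_eq : ∀ γ : SL(2, ℤ), F ∣[(0 : ℤ)] γ = F
  holo : MDifferentiable 𝓘(ℂ) 𝓘(ℂ) F
  expansion : (fun z : ℍ => F z - (nome z)⁻¹ ^ n) =O[atImInfty] nome

/-- `j_n`, the unique function satisfying `IsJ n`. -/
def jn (n : ℕ) : ℍ → ℂ := Classical.epsilon (IsJ n)

/-- `H` is the meromorphic function on `ℍ` given by the series `∑_{n ≥ 0} j_n(z) e^{2πinτ}` for
`τ` with sufficiently large imaginary part. The normal form fixes the values at all points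
of `ℍ` (`H` is continuous off its poles, and is given the value `0` at a pole), so that there is
exactly one such `H`. -/
structure IsHz (z : ℍ) (H : ℍ → ℂ) : Prop where
  mero : MeromorphicNFOn (H ∘ ofComplex) upperHalfPlaneSet
  series : ∀ᶠ τ : ℍ in atImInfty, HasSum (fun n : ℕ => jn n z * nome τ ^ n) (H τ)

/-- The generating function `H_z(τ)`, meromorphically continued to `ℍ` in the variable `τ`. -/
def Hz (z : ℍ) : ℍ → ℂ := Classical.epsilon (IsHz z)

/-- The order `ord_z(f)` of a meromorphic function on `ℍ` (not identically zero). -/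
def ordAt (f : ℍ → ℂ) (z : ℍ) : ℤ := (meromorphicOrderAt (f ∘ ofComplex) (z : ℂ)).untop₀

/-- The divisor modular form
`f^div(τ) = ∑_{z ∈ SL₂(ℤ) \ ℍ} 2 / |Stab_z(SL₂(ℤ))| · ord_z(f) · H_z(τ)`.
For modular `f` the summand depends only on the orbit of `z`, and is nonzero for only finitely
many orbits. -/
def divForm (f : ℍ → ℂ) (τ : ℍ) : ℂ :=
  ∑ᶠ p : MulAction.orbitRel.Quotient SL(2, ℤ) ℍ,
    (2 / (Nat.card (MulAction.stabilizer SL(2, ℤ) (Quotient.out p : ℍ)) : ℂ))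
      * (ordAt f (Quotient.out p) : ℂ) * Hz (Quotient.out p) τ

/-- `E₂(z) = 1 - 24 ∑_{n ≥ 1} ∑_{d ∣ n} d qⁿ`. -/
def E2 (z : ℍ) : ℂ := 1 - 24 * ∑' n : ℕ+, (∑ d ∈ (n : ℕ).divisors, (d : ℂ)) * nome z ^ (n : ℕ)

/-- `E₂*(z) = E₂(z) - 3 / (π y)`. -/
def E2star (z : ℍ) : ℂ := E2 z - 3 / (Real.pi * z.im)

/-- The first non-vanishing coefficient of the Fourier expansion of `f` about `i∞`, for a
`1`-periodic `f ≠ 0`, holomorphic on `ℍ` and at `i∞`. -/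
def firstCoeff (f : ℍ → ℂ) : ℂ :=
  (UpperHalfPlane.qExpansion 1 f).coeff (UpperHalfPlane.qExpansion 1 f).order.toNat

end ZagierForms

end

open ZagierForms

/-!
The form `f = f_{k,D}` is controlled by the identity `|Q(z,1)|² = y² (Q_z² + D)`: it shows that
`|Q(z,1)|` dominates the coefficients of `Q`, locally uniformly in `z`
(`IntQuadForm.exists_coeffNorm_le`), so that all series are dominated by `∑ ‖(a,b,c)‖⁻ᵏ` over `ℤ³`,
which converges since `k ≥ 4`. Together with `Q_z = -i Q'(z,1) + Q(z,1)/y` this gives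
`ω = (i/k) f' + f/y` (`omega_eq_deriv`), with `f` a modular form of weight `2k` (`fForm`). The
eigenvalue equation is then a computation valid for every holomorphic `f` (`hypLaplacian_of_eq`),
decay at `i∞` follows from `q df/dq → 0`, and `f/y` is not holomorphic because `y` is real-valued
(`eq_zero_of_mdifferentiable_div_im`).

For the divisor form let `D = (2πi)⁻¹ d/dz` and `j = E₄³/Δ`. Since `ω/f` is, up to a factor, `D f/f`
plus a multiple of `1/y`, the claim amounts to
`F^div = (k/6) E₂ - D F/F` for a modular form `F ≠ 0` of weight `2k` (`divForm_eq`). It rests on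
three facts.

* `j` induces a bijection `SL₂(ℤ) \ ℍ → ℂ` (`bijective_jQuot`), with ramification index
  `|Stab_z| / 2` at `z` (`exists_order_jInv_sub`). Surjectivity holds because the range is open and
  closed. For injectivity, the set of values taken on two different orbits is open, is relatively
  closed in `ℂ \ {0, 1728}`, where `j` is locally injective, and does not contain large values; as
  `ℂ \ {0, 1728}` is connected, it is empty.
* `H_z = -D j / (j - j(z)) = E₄² E₆ / (E₄³ - j(z) Δ)` (`Hz_eq`). Here `j_n = p_n(j)` for the Faber
  polynomials `p_n` of `j`, and `p_n(r)` is the `n`-th Taylor coefficient in `q` of `-D j / (j - r)`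
  by a residue computation (`coeff_eq_eval_faber`).
* `F ^ 6 = Δ ^ k P(j)` for a polynomial `P` (`exists_pow_six_eq`). Hence `6 ord_z F` is the
  multiplicity of `j(z)` as a root of `P` times the ramification index (`ordAt_mul_six`), and the
  sum defining `F^div` is the partial fraction expansion of `-(1/6) (P'/P)(j) D j`, which is
  `(k/6) E₂ - D F/F` by logarithmic differentiation, as `D Δ = E₂ Δ`.
-/

namespace ZagierForms

/-! ### Integral binary quadratic forms -/

namespace IntQuadForm

/-- The maximum of the absolute values of the coefficients. -/
noncomputable def coeffNorm (Q : IntQuadForm) : ℝ := ‖(![(Q.a : ℝ), Q.b, Q.c] : Fin 3 → ℝ)‖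

/-- `y Q_z = a |z|² + b x + c`, as a function of a complex variable. -/
noncomputable def geoNum (Q : IntQuadForm) (z : ℂ) : ℝ :=
  (Q.a : ℝ) * (z.re ^ 2 + z.im ^ 2) + (Q.b : ℝ) * z.re + (Q.c : ℝ)

lemma geo_eq (Q : IntQuadForm) (z : ℍ) : Q.geo z = Q.geoNum z / z.im := by
  simp only [geo, geoNum, Complex.sq_norm, Complex.normSq_apply, coe_re, coe_im]
  ring

lemma eval_re (Q : IntQuadForm) (z : ℂ) :
    (Q.eval z 1).re = Q.a * (z.re ^ 2 - z.im ^ 2) + Q.b * z.re + Q.c := by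
  simp [eval, pow_two]

lemma eval_im (Q : IntQuadForm) (z : ℂ) :
    (Q.eval z 1).im = z.im * (2 * Q.a * z.re + Q.b) := by
  simp [eval, pow_two]; ring

/-- The identity `|Q(z, 1)|² = y² (Q_z² + D)`. -/
lemma norm_eval_sq (Q : IntQuadForm) (z : ℂ) :
    ‖Q.eval z 1‖ ^ 2 = Q.geoNum z ^ 2 + Q.disc * z.im ^ 2 := by
  rw [Complex.sq_norm, Complex.normSq_apply, eval_re, eval_im, geoNum, disc]
  push_cast
  ring

lemma abs_geoNum_le {Q : IntQuadForm} (hQ : 0 < Q.disc) (z : ℂ) : |Q.geoNum z| ≤ ‖Q.eval z 1‖ := by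
  have hQ' : (0 : ℝ) < Q.disc := by exact_mod_cast hQ
  refine abs_le_of_sq_le_sq ?_ (norm_nonneg _)
  rw [norm_eval_sq]
  nlinarith [sq_nonneg z.im]

lemma eval_ne_zero {Q : IntQuadForm} (hQ : 0 < Q.disc) {z : ℂ} (hz : 0 < z.im) :
    Q.eval z 1 ≠ 0 := by
  have hQ' : (0 : ℝ) < Q.disc := by exact_mod_cast hQ
  have h : 0 < ‖Q.eval z 1‖ ^ 2 := by
    rw [norm_eval_sq]
    positivity
  intro h0
  simp [h0] at h

/-- For forms of positive discriminant, `|Q(z, 1)|` controls the coefficients, uniformly for `z` in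
a half-strip: it bounds `y Q_z` as well as the real and imaginary parts of `Q(z, 1)`, and these are
three independent linear forms in `(a, b, c)`. -/
lemma exists_coeffNorm_le (R : ℝ) {δ : ℝ} (hδ : 0 < δ) :
    ∃ M : ℝ, 0 < M ∧ ∀ (Q : IntQuadForm) (z : ℂ), 0 < Q.disc → |z.re| ≤ R → δ ≤ z.im →
      Q.coeffNorm ≤ M * ‖Q.eval z 1‖ := by
  have hδ2 : 0 < δ ^ 2 := by positivity
  set α : ℝ := (δ ^ 2)⁻¹
  set β : ℝ := δ⁻¹ + 2 * |R| * α
  refine ⟨1 + α + β + |R| ^ 2 * α + |R| * β, by positivity, fun Q z hQ hR hz => ?_⟩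
  set N := ‖Q.eval z 1‖
  have hN : 0 ≤ N := norm_nonneg _
  have hR' : |z.re| ≤ |R| := hR.trans (le_abs_self R)
  have hp := abs_geoNum_le hQ z
  have hr : |Q.a * (z.re ^ 2 - z.im ^ 2) + Q.b * z.re + Q.c| ≤ N :=
    eval_re Q z ▸ Complex.abs_re_le_norm _
  have hs : |z.im * (2 * Q.a * z.re + Q.b)| ≤ N := eval_im Q z ▸ Complex.abs_im_le_norm _
  have ha : |(Q.a : ℝ)| ≤ α * N := by
    have h1 : |(Q.a : ℝ)| * z.im ^ 2 ≤ N := by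
      have : (Q.a : ℝ) * z.im ^ 2 =
          (Q.geoNum z - (Q.a * (z.re ^ 2 - z.im ^ 2) + Q.b * z.re + Q.c)) / 2 := by
        rw [geoNum]; ring
      rw [← abs_of_nonneg (sq_nonneg z.im), ← abs_mul, this, abs_div, abs_two]
      have := abs_sub (Q.geoNum z) (Q.a * (z.re ^ 2 - z.im ^ 2) + Q.b * z.re + Q.c)
      linarith
    have h2 : |(Q.a : ℝ)| * δ ^ 2 ≤ N := le_trans (by gcongr) h1
    rw [inv_mul_eq_div, le_div_iff₀ hδ2]
    exact h2
  have hb : |(Q.b : ℝ)| ≤ β * N := by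
    have h1 : |2 * Q.a * z.re + Q.b| ≤ δ⁻¹ * N := by
      rw [abs_mul, abs_of_pos (hδ.trans_le hz)] at hs
      rw [inv_mul_eq_div, le_div_iff₀ hδ, mul_comm]
      exact le_trans (by gcongr) hs
    have h2 : |2 * Q.a * z.re| ≤ 2 * |R| * (α * N) := by
      rw [abs_mul, abs_mul, abs_two, mul_assoc, mul_assoc, mul_comm |R|]
      gcongr
    have h3 : |(Q.b : ℝ)| ≤ |2 * Q.a * z.re + Q.b| + |2 * Q.a * z.re| := by
      have := abs_sub (2 * Q.a * z.re + Q.b) (2 * Q.a * z.re)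
      simpa using this
    simp only [β]
    linarith
  have hc : |(Q.c : ℝ)| ≤ (1 + |R| ^ 2 * α + |R| * β) * N := by
    have h1 : (Q.c : ℝ) = (Q.geoNum z + (Q.a * (z.re ^ 2 - z.im ^ 2) + Q.b * z.re + Q.c)) / 2
        - Q.a * z.re ^ 2 - Q.b * z.re := by
      rw [geoNum]; ring
    have h2 : |Q.a * z.re ^ 2| ≤ |R| ^ 2 * (α * N) := by
      rw [abs_mul, abs_pow, mul_comm]
      gcongr
    have h3 : |Q.b * z.re| ≤ |R| * (β * N) := by
      rw [abs_mul, mul_comm]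
      gcongr
    rw [h1]
    have h4 := abs_add_le (Q.geoNum z) (Q.a * (z.re ^ 2 - z.im ^ 2) + Q.b * z.re + Q.c)
    rw [abs_le] at *
    constructor <;> linarith
  have hα : 0 ≤ α := by positivity
  have hβ : 0 ≤ β := by positivity
  have e1 : 0 ≤ α * N := by positivity
  have e2 : 0 ≤ β * N := by positivity
  have e3 : 0 ≤ |R| ^ 2 * α * N := by positivity
  have e4 : 0 ≤ |R| * β * N := by positivity
  rw [coeffNorm, pi_norm_le_iff_of_nonneg (by positivity)]
  intro i
  fin_cases i <;> simp [-sq_abs] <;> nlinarith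

lemma hasDerivAt_eval (Q : IntQuadForm) (z : ℂ) :
    HasDerivAt (fun w : ℂ => Q.eval w 1) (2 * Q.a * z + Q.b) z := by
  have : HasDerivAt (fun w : ℂ => (Q.a : ℂ) * w ^ 2 + (Q.b : ℂ) * w * 1 + (Q.c : ℂ) * 1 ^ 2)
      ((Q.a : ℂ) * (((2 : ℕ) : ℂ) * z ^ (2 - 1)) + (Q.b : ℂ) * 1 * 1) z :=
    (((hasDerivAt_pow 2 z).const_mul _).add (((hasDerivAt_id z).const_mul _).mul_const _)).add_const _
  convert this using 1
  · simp [eval]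
  · norm_num; ring

lemma evalDeriv_eq (Q : IntQuadForm) (z : ℂ) : Q.evalDeriv z = 2 * Q.a * z + Q.b :=
  (Q.hasDerivAt_eval z).deriv

/-- `Q_z = -i Q'(z, 1) + Q(z, 1) / y`. -/
lemma geo_eq_evalDeriv (Q : IntQuadForm) (z : ℍ) :
    (Q.geo z : ℂ) = -I * Q.evalDeriv z + 1 / (z.im : ℂ) * Q.eval z 1 := by
  have hy : (z.im : ℂ) ≠ 0 := by exact_mod_cast z.im_pos.ne'
  rw [geo_eq, geoNum, evalDeriv_eq, eval]
  push_cast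
  have hz : (z : ℂ) = z.re + z.im * I := by
    apply Complex.ext <;> simp
  rw [hz]
  simp only [add_re, add_im, mul_re, mul_im, ofReal_re, ofReal_im, Complex.I_re, Complex.I_im]
  field_simp
  ring_nf
  simp only [I_sq]
  ring

lemma norm_evalDeriv_le (Q : IntQuadForm) (z : ℂ) :
    ‖Q.evalDeriv z‖ ≤ (2 * ‖z‖ + 1) * Q.coeffNorm := by
  have h := fun i => norm_le_pi_norm (![(Q.a : ℝ), Q.b, Q.c] : Fin 3 → ℝ) i
  have ha : ‖(Q.a : ℂ)‖ ≤ Q.coeffNorm := by simpa [coeffNorm] using h 0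
  have hb : ‖(Q.b : ℂ)‖ ≤ Q.coeffNorm := by simpa [coeffNorm] using h 1
  rw [evalDeriv_eq]
  refine (norm_add_le _ _).trans ?_
  rw [norm_mul, norm_mul, Complex.norm_ofNat]
  nlinarith [norm_nonneg z]

end IntQuadForm

/-- The lattice `ℤ³` in `ℝ³`. -/
noncomputable def intLattice : Submodule ℤ (Fin 3 → ℝ) :=
  Submodule.span ℤ (Set.range (Pi.basisFun ℝ (Fin 3)))

instance : DiscreteTopology intLattice := by unfold intLattice; infer_instance

lemma finrank_intLattice : Module.finrank ℤ intLattice = 3 := by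
  have : IsZLattice ℝ intLattice := by unfold intLattice; infer_instance
  rw [ZLattice.rank ℝ intLattice]
  simp

lemma coeff_mem_intLattice (Q : IntQuadForm) :
    (![(Q.a : ℝ), Q.b, Q.c] : Fin 3 → ℝ) ∈ intLattice := by
  rw [intLattice, Module.Basis.mem_span_iff_repr_mem]
  intro i
  fin_cases i
  · exact ⟨Q.a, by simp⟩
  · exact ⟨Q.b, by simp⟩
  · exact ⟨Q.c, by simp⟩

/-- The series `∑ ‖(a, b, c)‖⁻ᵏ` over all integer vectors converges for `k > 3`. -/
lemma summable_coeffNorm {k : ℕ} (hk : 3 < k) :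
    Summable fun Q : IntQuadForm => Q.coeffNorm⁻¹ ^ k := by
  have h : Summable fun v : intLattice => ‖(v : Fin 3 → ℝ)‖⁻¹ ^ k :=
    ZLattice.summable_norm_pow_inv intLattice k (by rw [finrank_intLattice]; exact hk)
  let ι : IntQuadForm → intLattice := fun Q => ⟨_, coeff_mem_intLattice Q⟩
  have hinj : Function.Injective ι := by
    intro Q Q' h
    have h' : (![(Q.a : ℝ), Q.b, Q.c] : Fin 3 → ℝ) = ![(Q'.a : ℝ), Q'.b, Q'.c] :=
      congrArg Subtype.val h
    have h0 := congrFun h' 0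
    have h1 := congrFun h' 1
    have h2 := congrFun h' 2
    simp only [Matrix.cons_val, Int.cast_inj] at h0 h1 h2
    exact IntQuadForm.ext h0 h1 h2
  exact (h.comp_injective hinj).congr fun Q => rfl

/-! ### Convergence and holomorphy of the series -/

section Series

variable {k : ℕ} {D : ℤ}

lemma disc_pos (hD : 0 < D) (Q : QD D) : 0 < (Q : IntQuadForm).disc := by
  have : (Q : IntQuadForm).disc = D := Q.2
  rwa [this]

lemma coeffNorm_pos (hD : 0 < D) (Q : QD D) : 0 < (Q : IntQuadForm).coeffNorm := by
  rw [IntQuadForm.coeffNorm, norm_pos_iff]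
  intro h
  have h0 := congrFun h 0
  have h1 := congrFun h 1
  simp at h0 h1
  have := disc_pos hD Q
  simp [IntQuadForm.disc, h0, h1] at this

/-- A uniform summable majorant for the terms `Q(z, 1)⁻ᵏ` on a half-strip. -/
lemma exists_summable_bound (hk : 3 < k) (hD : 0 < D) (R : ℝ) {δ : ℝ} (hδ : 0 < δ) :
    ∃ u : QD D → ℝ, Summable u ∧ ∀ (Q : QD D) (z : ℂ), |z.re| ≤ R → δ ≤ z.im →
      ‖1 / (Q : IntQuadForm).eval z 1 ^ k‖ ≤ u Q := by
  obtain ⟨M, hM, h⟩ := IntQuadForm.exists_coeffNorm_le R hδ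
  refine ⟨fun Q => M ^ k * (Q : IntQuadForm).coeffNorm⁻¹ ^ k,
    ((summable_coeffNorm hk).comp_injective Subtype.val_injective).mul_left _, ?_⟩
  intro Q z hR hz
  have hpos := coeffNorm_pos hD Q
  have hle := h Q z (disc_pos hD Q) hR hz
  change _ ≤ M ^ k * (Q : IntQuadForm).coeffNorm⁻¹ ^ k
  rw [norm_div, norm_one, norm_pow, ← mul_pow, ← one_div_pow]
  have he : 0 < ‖(Q : IntQuadForm).eval z 1‖ := by
    by_contra h0
    nlinarith
  gcongr
  rw [← div_eq_mul_inv, div_le_div_iff₀ he hpos]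
  linarith

lemma summable_norm_inv_eval_pow (hk : 3 < k) (hD : 0 < D) {z : ℂ} (hz : 0 < z.im) :
    Summable fun Q : QD D => ‖1 / (Q : IntQuadForm).eval z 1 ^ k‖ := by
  obtain ⟨u, hu, h⟩ := exists_summable_bound hk hD |z.re| hz
  exact hu.of_nonneg_of_le (fun _ => norm_nonneg _) fun Q => h Q z le_rfl le_rfl

lemma summable_norm_geo_div (hk : 3 < k) (hD : 0 < D) (z : ℍ) :
    Summable fun Q : QD D =>
      ‖((Q : IntQuadForm).geo z : ℂ) / (Q : IntQuadForm).eval z 1 ^ (k + 1)‖ := by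
  refine ((summable_norm_inv_eval_pow hk hD z.coe_im_pos).mul_left z.im⁻¹).of_nonneg_of_le
    (fun _ => norm_nonneg _) fun Q => ?_
  have he := norm_pos_iff.mpr (IntQuadForm.eval_ne_zero (disc_pos hD Q) z.coe_im_pos)
  have hg := IntQuadForm.abs_geoNum_le (disc_pos hD Q) z
  have hy := z.im_pos
  rw [IntQuadForm.geo_eq, norm_div, norm_div, norm_pow, norm_pow, norm_one, norm_real,
    Real.norm_eq_abs, abs_div, abs_of_pos hy, pow_succ]
  rw [div_le_iff₀ (by positivity)]
  field_simp
  exact hg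

lemma summable_norm_evalDeriv_div (hk : 3 < k) (hD : 0 < D) (z : ℍ) :
    Summable fun Q : QD D =>
      ‖(Q : IntQuadForm).evalDeriv z / (Q : IntQuadForm).eval z 1 ^ (k + 1)‖ := by
  obtain ⟨M, hM, h⟩ := IntQuadForm.exists_coeffNorm_le |(z : ℂ).re| z.coe_im_pos
  refine ((summable_norm_inv_eval_pow hk hD z.coe_im_pos).mul_left
    ((2 * ‖(z : ℂ)‖ + 1) * M)).of_nonneg_of_le (fun _ => norm_nonneg _) fun Q => ?_
  have he := norm_pos_iff.mpr (IntQuadForm.eval_ne_zero (disc_pos hD Q) z.coe_im_pos)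
  have h1 := IntQuadForm.norm_evalDeriv_le Q z
  have h2 := h Q z (disc_pos hD Q) le_rfl le_rfl
  have h3 : ‖(Q : IntQuadForm).evalDeriv z‖ ≤
      (2 * ‖(z : ℂ)‖ + 1) * (M * ‖(Q : IntQuadForm).eval z 1‖) := h1.trans (by gcongr)
  rw [norm_div, norm_div, norm_pow, norm_pow, norm_one, pow_succ]
  rw [div_le_iff₀ (by positivity)]
  field_simp
  linarith

/-- Bounded open half-strips, on which the series converge uniformly. -/
def halfStrip (R δ : ℝ) : Set ℂ := {z | |z.re| < R ∧ δ < z.im}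

lemma isOpen_halfStrip (R δ : ℝ) : IsOpen (halfStrip R δ) :=
  (isOpen_lt (f := fun z : ℂ => |z.re|) (by fun_prop) continuous_const).inter
    (isOpen_lt (g := fun z : ℂ => z.im) continuous_const (by fun_prop))

lemma mem_halfStrip_self (z : ℍ) : (z : ℂ) ∈ halfStrip (|z.re| + 1) (z.im / 2) := by
  have := z.im_pos
  constructor
  · simp
  · simp only [coe_im]; linarith

lemma hasDerivAt_inv_eval_pow (k : ℕ) {Q : IntQuadForm} (hQ : 0 < Q.disc) {z : ℂ}
    (hz : 0 < z.im) : HasDerivAt (fun w : ℂ => 1 / Q.eval w 1 ^ k)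
      (-k * (Q.evalDeriv z / Q.eval z 1 ^ (k + 1))) z := by
  have h0 := IntQuadForm.eval_ne_zero hQ hz
  have h : HasDerivAt (fun w : ℂ => (Q.eval w 1 ^ k)⁻¹)
      (-(k * Q.eval z 1 ^ (k - 1) * (2 * Q.a * z + Q.b)) / (Q.eval z 1 ^ k) ^ 2) z :=
    ((Q.hasDerivAt_eval z).fun_pow k).fun_inv (pow_ne_zero k h0)
  simp only [one_div]
  refine h.congr_deriv ?_
  rw [IntQuadForm.evalDeriv_eq]
  rcases k with _ | k
  · simp
  · simp only [Nat.add_sub_cancel]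
    field_simp
    ring

/-- `f_{k,D}` as a series in a complex variable. -/
noncomputable def fSeries (k : ℕ) (D : ℤ) (z : ℂ) : ℂ :=
  ∑' Q : QD D, 1 / (Q : IntQuadForm).eval z 1 ^ k

lemma fkD_eq (z : ℍ) : fkD k D z = fSeries k D z := rfl

lemma differentiableOn_fSeries (hk : 3 < k) (hD : 0 < D) :
    DifferentiableOn ℂ (fSeries k D) upperHalfPlaneSet := by
  intro z hz
  have hz' := mem_halfStrip_self ⟨z, hz⟩
  have hδ : 0 < z.im / 2 := half_pos hz
  obtain ⟨u, hu, h⟩ := exists_summable_bound hk hD (|z.re| + 1) hδ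
  have := differentiableOn_tsum_of_summable_norm
    (F := fun (Q : QD D) (w : ℂ) => 1 / (Q : IntQuadForm).eval w 1 ^ k)
    (U := halfStrip (|z.re| + 1) (z.im / 2)) hu
    (fun Q w hw => (hasDerivAt_inv_eval_pow k (disc_pos hD Q)
      (hδ.trans hw.2)).differentiableAt.differentiableWithinAt)
    (isOpen_halfStrip _ _) (fun Q w hw => h Q w hw.1.le hw.2.le)
  exact ((this z hz').differentiableAt
    ((isOpen_halfStrip _ _).mem_nhds hz')).differentiableWithinAt

/-- Termwise differentiation of `f_{k,D}`. -/
lemma deriv_fSeries (hk : 3 < k) (hD : 0 < D) (z : ℍ) :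
    deriv (fSeries k D) z = -k * ∑' Q : QD D,
      (Q : IntQuadForm).evalDeriv z / (Q : IntQuadForm).eval z 1 ^ (k + 1) := by
  have hz' := mem_halfStrip_self z
  have hδ : 0 < z.im / 2 := half_pos z.im_pos
  obtain ⟨u, hu, h⟩ := exists_summable_bound hk hD (|z.re| + 1) hδ
  have := hasSum_deriv_of_summable_norm
    (F := fun (Q : QD D) (w : ℂ) => 1 / (Q : IntQuadForm).eval w 1 ^ k)
    (U := halfStrip (|z.re| + 1) (z.im / 2)) hu
    (fun Q w hw => (hasDerivAt_inv_eval_pow k (disc_pos hD Q)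
      (hδ.trans hw.2)).differentiableAt.differentiableWithinAt)
    (isOpen_halfStrip _ _) (fun Q w hw => h Q w hw.1.le hw.2.le) hz'
  rw [← tsum_mul_left]
  refine this.tsum_eq.symm.trans (tsum_congr fun Q => ?_)
  exact (hasDerivAt_inv_eval_pow k (disc_pos hD Q) z.coe_im_pos).deriv

lemma fkD_comp_ofComplex : Set.EqOn (fkD k D ∘ ofComplex) (fSeries k D) upperHalfPlaneSet :=
  fun z hz => by simp [fkD_eq, ofComplex_apply_of_im_pos hz]

lemma mdifferentiable_fkD (hk : 3 < k) (hD : 0 < D) : MDifferentiable 𝓘(ℂ) 𝓘(ℂ) (fkD k D) := by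
  rw [UpperHalfPlane.mdifferentiable_iff]
  exact (differentiableOn_fSeries hk hD).congr fkD_comp_ofComplex

lemma deriv_fkD (hk : 3 < k) (hD : 0 < D) (z : ℍ) :
    deriv (fkD k D ∘ ofComplex) z = -k * ∑' Q : QD D,
      (Q : IntQuadForm).evalDeriv z / (Q : IntQuadForm).eval z 1 ^ (k + 1) := by
  rw [← deriv_fSeries hk hD]
  exact (fkD_comp_ofComplex.eventuallyEq_of_mem
    (isOpen_upperHalfPlaneSet.mem_nhds z.coe_im_pos)).deriv_eq

lemma omega_eq_tsum (hk : 3 < k) (hD : 0 < D) (z : ℍ) : omega (k + 1) D z =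
    -I * (∑' Q : QD D, (Q : IntQuadForm).evalDeriv z / (Q : IntQuadForm).eval z 1 ^ (k + 1))
      + 1 / (z.im : ℂ) * fkD k D z := by
  rw [omega, fkD, ← tsum_mul_left, ← tsum_mul_left,
    ← Summable.tsum_add ((summable_norm_evalDeriv_div hk hD z).of_norm.mul_left _)
      ((summable_norm_inv_eval_pow hk hD z.coe_im_pos).of_norm.mul_left _)]
  refine tsum_congr fun Q => ?_
  have he := IntQuadForm.eval_ne_zero (disc_pos hD Q) z.coe_im_pos
  rw [IntQuadForm.geo_eq_evalDeriv, add_div, pow_succ]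
  field_simp

/-- `ω_{k+1,D} = (i/k) f_{k,D}' + f_{k,D} / y`. -/
lemma omega_eq_deriv (hk : 3 < k) (hD : 0 < D) (z : ℍ) : omega (k + 1) D z =
    I / k * deriv (fkD k D ∘ ofComplex) z + fkD k D z / z.im := by
  have hk0 : (k : ℂ) ≠ 0 := by exact_mod_cast (by lia : k ≠ 0)
  rw [omega_eq_tsum hk hD, deriv_fkD hk hD]
  field_simp

end Series

/-! ### Modularity -/

section Modularity

variable {k : ℕ} {D : ℤ}

lemma mem_QD {Q : IntQuadForm} : Q ∈ QD D ↔ Q.b ^ 2 - 4 * Q.a * Q.c = D := Iff.rfl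

/-- The bijection `Q(X, Y) ↦ Q(X + Y, Y)` of the forms of discriminant `D`. -/
def shiftEquiv (D : ℤ) : QD D ≃ QD D where
  toFun Q := ⟨⟨Q.1.a, 2 * Q.1.a + Q.1.b, Q.1.a + Q.1.b + Q.1.c⟩, by
    have h := mem_QD.1 Q.2; rw [mem_QD]; linear_combination h⟩
  invFun Q := ⟨⟨Q.1.a, Q.1.b - 2 * Q.1.a, Q.1.a - Q.1.b + Q.1.c⟩, by
    have h := mem_QD.1 Q.2; rw [mem_QD]; linear_combination h⟩
  left_inv Q := by ext <;> simp <;> ring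
  right_inv Q := by ext <;> simp <;> ring

/-- The bijection `Q(X, Y) ↦ Q(-Y, X)` of the forms of discriminant `D`. -/
def flipEquiv (D : ℤ) : QD D ≃ QD D where
  toFun Q := ⟨⟨Q.1.c, -Q.1.b, Q.1.a⟩, by
    have h := mem_QD.1 Q.2; rw [mem_QD]; linear_combination h⟩
  invFun Q := ⟨⟨Q.1.c, -Q.1.b, Q.1.a⟩, by
    have h := mem_QD.1 Q.2; rw [mem_QD]; linear_combination h⟩
  left_inv Q := by ext <;> simp
  right_inv Q := by ext <;> simp

lemma eval_shiftEquiv (Q : QD D) (z : ℂ) :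
    (shiftEquiv D Q : IntQuadForm).eval z 1 = (Q : IntQuadForm).eval (z + 1) 1 := by
  simp only [shiftEquiv, IntQuadForm.eval, Equiv.coe_fn_mk]
  push_cast
  ring

lemma geo_shiftEquiv (Q : QD D) (z : ℍ) :
    (shiftEquiv D Q : IntQuadForm).geo z = (Q : IntQuadForm).geo (ModularGroup.T • z) := by
  rw [IntQuadForm.geo_eq, IntQuadForm.geo_eq]
  simp only [shiftEquiv, IntQuadForm.geoNum, Equiv.coe_fn_mk, modular_T_smul, coe_vadd, coe_im,
    add_re, add_im, ofReal_re, ofReal_im, coe_re, vadd_im]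
  push_cast
  ring

lemma eval_flipEquiv (Q : QD D) {z : ℂ} (hz : z ≠ 0) :
    (flipEquiv D Q : IntQuadForm).eval z 1 = z ^ 2 * (Q : IntQuadForm).eval (-z)⁻¹ 1 := by
  simp only [flipEquiv, IntQuadForm.eval, Equiv.coe_fn_mk]
  push_cast
  field_simp
  ring

lemma geo_flipEquiv (Q : QD D) (z : ℍ) :
    (flipEquiv D Q : IntQuadForm).geo z = (Q : IntQuadForm).geo (ModularGroup.S • z) := by
  have hy := z.im_pos
  have hN : 0 < normSq (z : ℂ) := normSq_pos z
  rw [IntQuadForm.geo, IntQuadForm.geo, modular_S_smul]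
  have h1 : (UpperHalfPlane.mk (-(z : ℂ))⁻¹ z.im_inv_neg_coe_pos).re = -z.re / normSq (z : ℂ) := by
    change ((-(z : ℂ))⁻¹).re = _
    simp [inv_re, neg_div]
  have h2 : (UpperHalfPlane.mk (-(z : ℂ))⁻¹ z.im_inv_neg_coe_pos).im = z.im / normSq (z : ℂ) := by
    change ((-(z : ℂ))⁻¹).im = _
    simp [inv_im, neg_div]
  rw [h1, h2]
  simp only [flipEquiv, Equiv.coe_fn_mk, norm_inv, norm_neg, inv_pow, Complex.sq_norm]
  push_cast
  field_simp
  ring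

lemma slash_T_apply (f : ℍ → ℂ) (κ : ℤ) (z : ℍ) :
    (f ∣[κ] ModularGroup.T) z = f (ModularGroup.T • z) := by
  rw [ModularForm.SL_slash_apply]
  rw [ModularGroup.denom_apply]
  simp [ModularGroup.T]

lemma slash_S_apply (f : ℍ → ℂ) (κ : ℤ) (z : ℍ) :
    (f ∣[κ] ModularGroup.S) z = f (ModularGroup.S • z) * (z : ℂ) ^ (-κ) := by
  rw [ModularForm.SL_slash_apply]
  rw [ModularGroup.denom_apply]
  simp [ModularGroup.S]

lemma fkD_slash (γ : SL(2, ℤ)) : fkD k D ∣[(2 * k : ℤ)] γ = fkD k D := by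
  refine SlashInvariantForm.slash_action_generators_SL2Z ?_ ?_ γ
  · ext z
    rw [slash_S_apply, fkD, fkD, ← (flipEquiv D).tsum_eq
      (fun Q : QD D => 1 / (Q : IntQuadForm).eval z 1 ^ k), ← tsum_mul_right]
    refine tsum_congr fun Q => ?_
    rw [eval_flipEquiv Q z.ne_zero, modular_S_smul]
    have hz := z.ne_zero
    rw [mul_pow, ← pow_mul, zpow_neg]
    norm_cast
    ring
  · ext z
    rw [slash_T_apply, fkD, fkD, ← (shiftEquiv D).tsum_eq
      (fun Q : QD D => 1 / (Q : IntQuadForm).eval z 1 ^ k)]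
    refine tsum_congr fun Q => ?_
    rw [eval_shiftEquiv, modular_T_smul, coe_vadd, add_comm]
    simp

lemma omega_slash (γ : SL(2, ℤ)) : omega (k + 1) D ∣[(2 * k + 2 : ℤ)] γ = omega (k + 1) D := by
  refine SlashInvariantForm.slash_action_generators_SL2Z ?_ ?_ γ
  · ext z
    rw [slash_S_apply, omega, omega, ← (flipEquiv D).tsum_eq (fun Q : QD D =>
      ((Q : IntQuadForm).geo z : ℂ) / (Q : IntQuadForm).eval z 1 ^ (k + 1)),
      ← tsum_mul_right]
    refine tsum_congr fun Q => ?_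
    rw [eval_flipEquiv Q z.ne_zero, geo_flipEquiv, modular_S_smul]
    have hz := z.ne_zero
    rw [mul_pow, ← pow_mul, zpow_neg, show (2 * k + 2 : ℤ) = ((2 * (k + 1) : ℕ) : ℤ) by
      push_cast; ring, zpow_natCast]
    ring
  · ext z
    rw [slash_T_apply, omega, omega, ← (shiftEquiv D).tsum_eq (fun Q : QD D =>
      ((Q : IntQuadForm).geo z : ℂ) / (Q : IntQuadForm).eval z 1 ^ (k + 1))]
    refine tsum_congr fun Q => ?_
    rw [eval_shiftEquiv, geo_shiftEquiv, modular_T_smul, coe_vadd, add_comm (z : ℂ)]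
    simp

lemma isBoundedAtImInfty_fkD (hk : 3 < k) (hD : 0 < D) : IsBoundedAtImInfty (fkD k D) := by
  obtain ⟨u, hu, h⟩ := exists_summable_bound hk hD 1 one_pos
  rw [isBoundedAtImInfty_iff]
  refine ⟨∑' Q, u Q, 1, fun z hz => ?_⟩
  -- translate `z` into the strip `|x| ≤ 1/2`
  have hper : ∀ w : ℍ, fkD k D (ModularGroup.T ^ (-round z.re) • w) = fkD k D w := by
    intro w
    have h1 := congrFun (fkD_slash (k := k) (D := D) (ModularGroup.T ^ (-round z.re))) w
    rw [ModularForm.SL_slash_apply] at h1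
    simpa only [ModularGroup.denom_apply, ModularGroup.coe_T_zpow, Matrix.of_apply,
      Matrix.cons_val, Int.cast_zero, Int.cast_one, zero_mul, zero_add, one_zpow, mul_one] using h1
  rw [← hper, fkD]
  refine tsum_of_norm_bounded hu.hasSum fun Q => h Q _ ?_ ?_
  · rw [coe_re, ModularGroup.re_T_zpow_smul]
    push_cast
    rw [← sub_eq_add_neg]
    exact (abs_sub_round z.re).trans (by norm_num)
  · rw [coe_im, ModularGroup.im_T_zpow_smul]
    exact hz

/-- A holomorphic function that is invariant under the weight `κ` action of `SL₂(ℤ)` and bounded at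
`i∞`, as a modular form. -/
noncomputable def levelOneForm {κ : ℤ} (f : ℍ → ℂ) (hslash : ∀ γ : SL(2, ℤ), f ∣[κ] γ = f)
    (hholo : MDifferentiable 𝓘(ℂ) 𝓘(ℂ) f) (hbdd : IsBoundedAtImInfty f) : ModularForm 𝒮ℒ κ where
  toFun := f
  slash_action_eq' := fun _ ⟨γ, hγ⟩ => hγ ▸ hslash γ
  holo' := hholo
  bdd_at_cusps' {c} hc := by
    rw [Subgroup.IsArithmetic.isCusp_iff_isCusp_SL2Z] at hc
    rw [OnePoint.isBoundedAt_iff_forall_SL2Z hc]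
    intro γ _
    rw [hslash γ]
    exact hbdd

/-- `f_{k,D}` as a modular form of weight `2k`. -/
noncomputable def fForm (hk : 3 < k) (hD : 0 < D) : ModularForm 𝒮ℒ (2 * k : ℤ) :=
  levelOneForm (fkD k D) fkD_slash (mdifferentiable_fkD hk hD) (isBoundedAtImInfty_fkD hk hD)

end Modularity

/-! ### Differential operators on functions `φ(z) / yⁿ` -/

section Calculus

lemma exists_hasFDerivAt_div_im_pow {φ : ℂ → ℂ} {φ' z : ℂ} (hφ : HasDerivAt φ φ' z)
    (hz : z.im ≠ 0) (n : ℕ) :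
    ∃ L : ℂ →L[ℝ] ℂ, HasFDerivAt (fun w => φ w / (w.im : ℂ) ^ n) L z ∧
      L 1 = φ' / (z.im : ℂ) ^ n ∧ L I = I * φ' / (z.im : ℂ) ^ n - n * φ z / (z.im : ℂ) ^ (n + 1) := by
  have h1 : HasFDerivAt φ (((1 : ℂ →L[ℂ] ℂ).smulRight φ').restrictScalars ℝ) z :=
    hφ.hasFDerivAt.restrictScalars ℝ
  have h2 : HasDerivAt (fun y : ℝ => ((y : ℂ) ^ n)⁻¹)
      (-(n * (z.im : ℂ) ^ (n - 1)) / ((z.im : ℂ) ^ n) ^ 2) z.im := by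
    have := ((hasDerivAt_pow n (z.im : ℂ)).fun_inv
      (pow_ne_zero n (by exact_mod_cast hz))).comp_ofReal
    exact this
  have h3 : HasFDerivAt (fun w : ℂ => w.im) imCLM z := imCLM.hasFDerivAt
  have h4 := h1.mul (h2.hasFDerivAt.comp z h3)
  have hy : (z.im : ℂ) ≠ 0 := by exact_mod_cast hz
  refine ⟨_, h4.congr_of_eventuallyEq (Eventually.of_forall fun w => ?_), ?_, ?_⟩
  · simp [div_eq_mul_inv]
  · simp [div_eq_mul_inv, mul_comm]
  · rcases n with _ | n
    · simp
    · simp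
      field_simp
      ring

variable {φ : ℂ → ℂ} {z : ℂ}

lemma dx_div_im_pow (hφ : DifferentiableAt ℂ φ z) (hz : z.im ≠ 0) (n : ℕ) :
    dx (fun w => φ w / (w.im : ℂ) ^ n) z = deriv φ z / (z.im : ℂ) ^ n := by
  obtain ⟨L, hL, h1, -⟩ := exists_hasFDerivAt_div_im_pow hφ.hasDerivAt hz n
  rw [dx, hL.fderiv, h1]

lemma dy_div_im_pow (hφ : DifferentiableAt ℂ φ z) (hz : z.im ≠ 0) (n : ℕ) :
    dy (fun w => φ w / (w.im : ℂ) ^ n) z =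
      I * deriv φ z / (z.im : ℂ) ^ n - n * φ z / (z.im : ℂ) ^ (n + 1) := by
  obtain ⟨L, hL, -, h1⟩ := exists_hasFDerivAt_div_im_pow hφ.hasDerivAt hz n
  rw [dy, hL.fderiv, h1]

lemma differentiableAt_div_im_pow (hφ : DifferentiableAt ℂ φ z) (hz : z.im ≠ 0) (n : ℕ) :
    DifferentiableAt ℝ (fun w => φ w / (w.im : ℂ) ^ n) z :=
  (exists_hasFDerivAt_div_im_pow hφ.hasDerivAt hz n).choose_spec.1.differentiableAt

lemma dx_add {F G : ℂ → ℂ} (hF : DifferentiableAt ℝ F z) (hG : DifferentiableAt ℝ G z) :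
    dx (fun w => F w + G w) z = dx F z + dx G z := by
  simp [dx, fderiv_fun_add hF hG]

lemma dy_add {F G : ℂ → ℂ} (hF : DifferentiableAt ℝ F z) (hG : DifferentiableAt ℝ G z) :
    dy (fun w => F w + G w) z = dy F z + dy G z := by
  simp [dy, fderiv_fun_add hF hG]

lemma _root_.Filter.EventuallyEq.dx_eq {F G : ℂ → ℂ} (h : F =ᶠ[𝓝 z] G) : dx F z = dx G z := by
  rw [dx, dx, h.fderiv_eq]

lemma _root_.Filter.EventuallyEq.dy_eq {F G : ℂ → ℂ} (h : F =ᶠ[𝓝 z] G) : dy F z = dy G z := by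
  rw [dy, dy, h.fderiv_eq]

/-- If `g` is holomorphic then `(i/k) g' + g/y` is an eigenfunction of `Δ_{2k+2}` with eigenvalue
`2k`. -/
lemma hypLaplacian_of_eq {g : ℂ → ℂ} (hg : DifferentiableOn ℂ g upperHalfPlaneSet) {k : ℕ}
    (hk : k ≠ 0) {F : ℍ → ℂ} (hF : ∀ z : ℍ, F z = I / k * deriv g z + g z / z.im) (z : ℍ) :
    hypLaplacian (2 * k + 2) F z = 2 * k * F z := by
  have hU := isOpen_upperHalfPlaneSet
  have hk' : (k : ℂ) ≠ 0 := by exact_mod_cast hk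
  have d0 : ∀ w ∈ upperHalfPlaneSet, DifferentiableAt ℂ g w := fun w hw =>
    hg.differentiableAt (hU.mem_nhds hw)
  have d1 : ∀ w ∈ upperHalfPlaneSet, DifferentiableAt ℂ (deriv g) w := fun w hw =>
    (hg.deriv hU).differentiableAt (hU.mem_nhds hw)
  have d2 : ∀ w ∈ upperHalfPlaneSet, DifferentiableAt ℂ (deriv (deriv g)) w := fun w hw =>
    ((hg.deriv hU).deriv hU).differentiableAt (hU.mem_nhds hw)
  have him : ∀ w ∈ upperHalfPlaneSet, w.im ≠ 0 := fun w hw => ne_of_gt hw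
  set h : ℂ → ℂ := fun w => I / k * deriv g w with hdef
  have dh : ∀ w ∈ upperHalfPlaneSet, DifferentiableAt ℂ h w := fun w hw => (d1 w hw).const_mul _
  have eh : deriv h = fun w => I / k * deriv (deriv g) w := by
    ext w; simp [hdef]
  -- the first partial derivatives on the upper half-plane
  have e0 : Set.EqOn (F ∘ ofComplex) (fun w => h w / (w.im : ℂ) ^ 0 + g w / (w.im : ℂ) ^ 1)
      upperHalfPlaneSet := by
    intro w hw
    simp [ofComplex_apply_of_im_pos hw, hF, hdef]
  have ex : Set.EqOn (dx (F ∘ ofComplex))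
      (fun w => deriv h w / (w.im : ℂ) ^ 0 + deriv g w / (w.im : ℂ) ^ 1) upperHalfPlaneSet := by
    intro w hw
    rw [(e0.eventuallyEq_of_mem (hU.mem_nhds hw)).dx_eq,
      dx_add (differentiableAt_div_im_pow (dh w hw) (him w hw) 0)
        (differentiableAt_div_im_pow (d0 w hw) (him w hw) 1),
      dx_div_im_pow (dh w hw) (him w hw), dx_div_im_pow (d0 w hw) (him w hw)]
  have ey : Set.EqOn (dy (F ∘ ofComplex))
      (fun w => (I * deriv h w) / (w.im : ℂ) ^ 0 + ((I * deriv g w) / (w.im : ℂ) ^ 1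
        + (-g w) / (w.im : ℂ) ^ 2)) upperHalfPlaneSet := by
    intro w hw
    rw [(e0.eventuallyEq_of_mem (hU.mem_nhds hw)).dy_eq,
      dy_add (differentiableAt_div_im_pow (dh w hw) (him w hw) 0)
        (differentiableAt_div_im_pow (d0 w hw) (him w hw) 1),
      dy_div_im_pow (dh w hw) (him w hw), dy_div_im_pow (d0 w hw) (him w hw)]
    simp
    ring
  have hz : (z : ℂ) ∈ upperHalfPlaneSet := z.coe_im_pos
  have dh' : ∀ w ∈ upperHalfPlaneSet, DifferentiableAt ℂ (deriv h) w := fun w hw => by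
    rw [eh]; exact (d2 w hw).const_mul _
  have exx : dx (dx (F ∘ ofComplex)) z =
      deriv (deriv h) z / (z.im : ℂ) ^ 0 + deriv (deriv g) z / (z.im : ℂ) ^ 1 := by
    rw [(ex.eventuallyEq_of_mem (hU.mem_nhds hz)).dx_eq,
      dx_add (differentiableAt_div_im_pow (dh' _ hz) (him _ hz) 0)
        (differentiableAt_div_im_pow (d1 _ hz) (him _ hz) 1),
      dx_div_im_pow (dh' _ hz) (him _ hz), dx_div_im_pow (d1 _ hz) (him _ hz)]
    rfl
  have eyy : dy (dy (F ∘ ofComplex)) z =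
      I * (I * deriv (deriv h) z) / (z.im : ℂ) ^ 0 +
      ((I * (I * deriv (deriv g) z) / (z.im : ℂ) ^ 1 - I * deriv g z / (z.im : ℂ) ^ 2)
        + (I * (-deriv g z) / (z.im : ℂ) ^ 2 - 2 * (-g z) / (z.im : ℂ) ^ 3)) := by
    have i1 := differentiableAt_div_im_pow ((dh' _ hz).const_mul I) (him _ hz) 0
    have i2 := differentiableAt_div_im_pow ((d1 _ hz).const_mul I) (him _ hz) 1
    have i3 := differentiableAt_div_im_pow ((d0 _ hz).fun_neg) (him _ hz) 2
    rw [(ey.eventuallyEq_of_mem (hU.mem_nhds hz)).dy_eq, dy_add i1 (i2.fun_add i3), dy_add i2 i3,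
      dy_div_im_pow ((dh' _ hz).const_mul I) (him _ hz),
      dy_div_im_pow ((d1 _ hz).const_mul I) (him _ hz),
      dy_div_im_pow ((d0 _ hz).fun_neg) (him _ hz), deriv_const_mul _ (dh' _ hz),
      deriv_const_mul _ (d1 _ hz), deriv.fun_neg]
    simp
  have hy : (z.im : ℂ) ≠ 0 := by exact_mod_cast z.im_pos.ne'
  rw [hypLaplacian, exx, eyy, ex hz, ey hz, hF z]
  simp only [hdef]
  push_cast
  simp only [coe_im]
  field_simp
  ring_nf
  simp only [I_sq, I_pow_three]
  ring_nf

lemma contDiffOn_of_eq {g : ℂ → ℂ} (hg : DifferentiableOn ℂ g upperHalfPlaneSet) {c : ℂ}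
    {F : ℍ → ℂ} (hF : ∀ z : ℍ, F z = c * deriv g z + g z / z.im) :
    ContDiffOn ℝ ∞ (F ∘ ofComplex) upperHalfPlaneSet := by
  have hU := isOpen_upperHalfPlaneSet
  have h0 : ContDiffOn ℝ ∞ g upperHalfPlaneSet := (hg.contDiffOn hU).restrict_scalars ℝ
  have h1 : ContDiffOn ℝ ∞ (deriv g) upperHalfPlaneSet :=
    ((hg.deriv hU).contDiffOn hU).restrict_scalars ℝ
  have h2 : ContDiffOn ℝ ∞ (fun w : ℂ => (w.im : ℂ)) upperHalfPlaneSet :=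
    (ofRealCLM.contDiff.comp imCLM.contDiff).contDiffOn
  refine (((contDiffOn_const (c := c)).mul h1).add (h0.mul (h2.inv fun w hw => ?_))).congr fun w hw => ?_
  · exact_mod_cast ne_of_gt hw
  · simp [ofComplex_apply_of_im_pos hw, hF, div_eq_mul_inv]

/-- If `f` and `f/y` are both holomorphic on `ℍ` then `f = 0`: off the zeros of `f` the
real-valued function `1/y` would be holomorphic. -/
lemma eq_zero_of_mdifferentiable_div_im {f : ℍ → ℂ} (hf : MDifferentiable 𝓘(ℂ) 𝓘(ℂ) f)
    (h : MDifferentiable 𝓘(ℂ) 𝓘(ℂ) (fun z : ℍ => 1 / (z.im : ℂ) * f z)) : f = 0 := by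
  ext z
  by_contra hz
  have h1 := UpperHalfPlane.mdifferentiableAt_iff.mp (hf z)
  have h2 := UpperHalfPlane.mdifferentiableAt_iff.mp (h z)
  have hU := isOpen_upperHalfPlaneSet
  have hne : (z.im : ℂ) ≠ 0 := by exact_mod_cast z.im_pos.ne'
  -- `y = f / (f / y)` is complex differentiable at `z`
  have h3 : DifferentiableAt ℂ (fun w : ℂ => (w.im : ℂ)) z := by
    have hq := h1.div h2 (by simpa [hne] using hz)
    refine hq.congr_of_eventuallyEq ?_
    have hc := h1.continuousAt.eventually_ne (y := 0) (by simpa using hz)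
    filter_upwards [hc, hU.mem_nhds z.coe_im_pos] with w hw hw'
    have hw'' : (w.im : ℂ) ≠ 0 := by exact_mod_cast ne_of_gt hw'
    simp only [Function.comp_apply] at hw
    simp [ofComplex_apply_of_im_pos hw'] at hw ⊢
    field_simp
  obtain ⟨d, hd⟩ := h3
  have hd' : HasFDerivAt (fun w : ℂ => (w.im : ℂ)) (d.restrictScalars ℝ) (z : ℂ) :=
    hd.restrictScalars ℝ
  have hu := hd'.unique (ofRealCLM.hasFDerivAt.comp (z : ℂ) imCLM.hasFDerivAt)
  have e1 : d 1 = 0 := by simpa using DFunLike.congr_fun hu 1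
  have e2 : d I = 1 := by simpa using DFunLike.congr_fun hu I
  have e3 : d I = I * d 1 := by simpa using d.map_smul I 1
  rw [e1, e2, mul_zero] at e3
  exact one_ne_zero e3

end Calculus

/-! ### Derivatives and cusp functions -/

section CuspFunction

open Function.Periodic Derivative

lemma hasDerivAt_qParam (z : ℂ) : HasDerivAt (qParam 1) (2 * Real.pi * I * qParam 1 z) z := by
  have h : HasDerivAt (fun w : ℂ => Complex.exp (2 * Real.pi * I * w))
      (Complex.exp (2 * Real.pi * I * z) * (2 * Real.pi * I * 1)) z :=
    ((hasDerivAt_id z).const_mul _).cexp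
  have e : (qParam 1) = fun w : ℂ => Complex.exp (2 * Real.pi * I * w) := by
    ext w; simp [qParam]
  rw [e]
  exact h.congr_deriv (by ring)

lemma nome_eq (z : ℍ) : nome z = qParam 1 z := by simp [nome, qParam]

variable {F : Type*} [FunLike F ℍ ℂ] {k : ℤ}

lemma comp_ofComplex_eventuallyEq [ModularFormClass F 𝒮ℒ k] (f : F) (z : ℍ) :
    (⇑f ∘ ofComplex) =ᶠ[𝓝 (z : ℂ)] fun w => cuspFunction 1 ⇑f (qParam 1 w) := by
  filter_upwards [isOpen_upperHalfPlaneSet.mem_nhds z.coe_im_pos] with w hw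
  have := SlashInvariantFormClass.eq_cuspFunction f ⟨w, hw⟩ one_mem_strictPeriods_SL one_ne_zero
  simp [ofComplex_apply_of_im_pos hw, this]

lemma norm_qParam_lt_one' (z : ℍ) : ‖qParam 1 (z : ℂ)‖ < 1 := norm_qParam_lt_one one_pos z.im_pos

lemma differentiableAt_cuspFunction' [ModularFormClass F 𝒮ℒ k] (f : F) {q : ℂ} (hq : ‖q‖ < 1) :
    DifferentiableAt ℂ (cuspFunction 1 ⇑f) q :=
  ModularFormClass.differentiableAt_cuspFunction f one_pos one_mem_strictPeriods_SL hq

/-- `D f = q d/dq f`. -/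
lemma normalizedDeriv_eq [ModularFormClass F 𝒮ℒ k] (f : F) (z : ℍ) :
    D f z = qParam 1 (z : ℂ) * deriv (cuspFunction 1 ⇑f) (qParam 1 (z : ℂ)) := by
  have h := (differentiableAt_cuspFunction' f (norm_qParam_lt_one' z)).hasDerivAt.comp (z : ℂ)
    (hasDerivAt_qParam z)
  rw [normalizedDerivOfComplex, (comp_ofComplex_eventuallyEq f z).deriv_eq]
  have h2 := h.deriv
  rw [Function.comp_def] at h2
  rw [h2]
  have : (2 * Real.pi * I : ℂ) ≠ 0 := two_pi_I_ne_zero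
  field_simp

lemma tendsto_normalizedDeriv [ModularFormClass F 𝒮ℒ k] (f : F) :
    Tendsto (D f) atImInfty (𝓝 0) := by
  have h1 : ContinuousAt (fun q => q * deriv (cuspFunction 1 ⇑f) q) 0 :=
    continuousAt_id.mul
      (ModularFormClass.analyticAt_cuspFunction_zero f one_pos one_mem_strictPeriods_SL).deriv.continuousAt
  have h2 := h1.tendsto.comp (qParam_tendsto_atImInfty one_pos)
  rw [zero_mul] at h2
  exact h2.congr fun z => (normalizedDeriv_eq f z).symm

/-- A modular form tends at `i∞` to the constant coefficient of its `q`-expansion. -/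
lemma tendsto_atImInfty_coeff_zero [ModularFormClass F 𝒮ℒ k] (f : F) :
    Tendsto f atImInfty (𝓝 ((qExpansion 1 f).coeff 0)) := by
  have h1 := (differentiableAt_cuspFunction' f (q := 0) (by simp)).continuousAt.tendsto.comp
    (qParam_tendsto_atImInfty one_pos)
  have h2 : (qExpansion 1 f).coeff 0 = cuspFunction 1 f 0 := by simp [qExpansion_coeff]
  rw [h2]
  exact h1.congr fun z =>
    SlashInvariantFormClass.eq_cuspFunction f z one_mem_strictPeriods_SL one_ne_zero

lemma modularForm_smul [ModularFormClass F 𝒮ℒ k] (f : F) (γ : SL(2, ℤ)) (z : ℍ) :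
    f (γ • z) = denom γ z ^ k * f z := by
  have h := congrFun (SlashInvariantFormClass.slash_action_eq f (γ : GL (Fin 2) ℝ) ⟨γ, rfl⟩) z
  rw [← ModularForm.SL_slash, ModularForm.SL_slash_apply, zpow_neg,
    mul_inv_eq_iff_eq_mul₀ (zpow_ne_zero _ (denom_ne_zero _ _))] at h
  rw [mul_comm]
  exact h

end CuspFunction

/-! ### The function `ω_{k+1,D}` -/

section Omega

open Derivative

variable {k : ℕ} {d : ℤ}

/-- `ω_{k+1,D}` in terms of the normalized derivative `D = (2πi)⁻¹ d/dz`. -/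
lemma omega_eq (hk : 3 < k) (hd : 0 < d) (z : ℍ) : omega (k + 1) d z =
    -(2 * Real.pi / k) * D (fkD k d) z + fkD k d z / z.im := by
  have hk0 : (k : ℂ) ≠ 0 := by exact_mod_cast (by lia : k ≠ 0)
  have hπ : (Real.pi : ℂ) ≠ 0 := by exact_mod_cast Real.pi_ne_zero
  rw [omega_eq_deriv hk hd, normalizedDerivOfComplex]
  field_simp
  linear_combination deriv (fkD k d ∘ ofComplex) z * I_sq

lemma tendsto_omega (hk : 3 < k) (hd : 0 < d) :
    Tendsto (omega (k + 1) d) atImInfty (𝓝 0) := by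
  have h1 := (tendsto_normalizedDeriv (fForm hk hd)).const_mul (-(2 * Real.pi / k : ℂ))
  have h2 : Tendsto (fun z : ℍ => fkD k d z / z.im) atImInfty (𝓝 0) := by
    have hb : IsBigO atImInfty (fkD k d) (fun _ => (1 : ℝ)) := isBoundedAtImInfty_fkD hk hd
    have hi : Tendsto (fun z : ℍ => (z.im)⁻¹) atImInfty (𝓝 0) :=
      tendsto_inv_atTop_zero.comp tendsto_comap
    have hi' : Tendsto (fun z : ℍ => ((z.im : ℂ))⁻¹) atImInfty (𝓝 0) := by
      have := (continuous_ofReal.tendsto 0).comp hi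
      simpa [Function.comp_def] using this
    have := hb.mul_isLittleO ((isLittleO_one_iff ℝ).mpr hi')
    simpa [div_eq_mul_inv] using (isLittleO_one_iff ℝ).mp (this.congr_right (by simp))
  have := h1.add h2
  rw [mul_zero, zero_add] at this
  exact this.congr fun z => (omega_eq hk hd z).symm

lemma isWeakMaassForm_omega (hk : 3 < k) (hd : 0 < d) :
    IsWeakMaassForm (2 * k + 2) (2 * k) (omega (k + 1) d) where
  smooth := contDiffOn_of_eq (g := fkD k d ∘ ofComplex) (c := I / k)
    (UpperHalfPlane.mdifferentiable_iff.mp (mdifferentiable_fkD hk hd))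
    (fun z => by rw [omega_eq_deriv hk hd]; simp)
  slash_eq := omega_slash
  eigen := hypLaplacian_of_eq (g := fkD k d ∘ ofComplex)
    (UpperHalfPlane.mdifferentiable_iff.mp (mdifferentiable_fkD hk hd)) (by lia)
    (fun z => by rw [omega_eq_deriv hk hd]; simp)
  growth γ := by
    refine ⟨0, ?_⟩
    rw [omega_slash]
    simpa using (tendsto_omega hk hd).isBigO_one ℝ

lemma mdifferentiable_tsum_evalDeriv (hk : 3 < k) (hd : 0 < d) :
    MDifferentiable 𝓘(ℂ) 𝓘(ℂ) (fun z : ℍ => -I * (∑' Q : QD d,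
      (Q : IntQuadForm).evalDeriv z / (Q : IntQuadForm).eval z 1 ^ (k + 1))) := by
  have hk0 : (k : ℂ) ≠ 0 := by exact_mod_cast (by lia : k ≠ 0)
  have h := (UpperHalfPlane.mdifferentiable_iff.mp (mdifferentiable_fkD hk hd)).deriv
    isOpen_upperHalfPlaneSet
  rw [UpperHalfPlane.mdifferentiable_iff]
  refine (h.const_mul (I / k)).congr fun z hz => ?_
  have := deriv_fkD (k := k) hk hd ⟨z, hz⟩
  rw [show ((⟨z, hz⟩ : ℍ) : ℂ) = z from rfl] at this
  rw [this]
  simp only [Function.comp_apply, ofComplex_apply_of_im_pos hz]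
  field_simp

end Omega

/-! ### The modular invariant -/

section JInvariant

open Derivative ModularForm

lemma deriv_discriminant_comp (z : ℍ) : deriv (discriminant ∘ ofComplex) z =
    2 * Real.pi * I * (EisensteinSeries.E2 z * discriminant z) := by
  have h1 : (discriminant ∘ ofComplex) =ᶠ[𝓝 (z : ℂ)] fun w => ModularForm.eta w ^ 24 := by
    filter_upwards [isOpen_upperHalfPlaneSet.mem_nhds z.coe_im_pos] with w hw
    simp [discriminant, ofComplex_apply_of_im_pos hw]
  have hd := differentiableAt_eta_of_mem_upperHalfPlaneSet z.coe_im_pos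
  have h2 := logDeriv_eta_eq_E2 z
  have h3 := eta_ne_zero z.coe_im_pos
  rw [logDeriv_apply, div_eq_iff h3] at h2
  rw [h1.deriv_eq, deriv_fun_pow hd, h2, discriminant]
  push_cast
  ring

lemma D_discriminant (z : ℍ) : D discriminant z = EisensteinSeries.E2 z * discriminant z := by
  rw [normalizedDerivOfComplex, deriv_discriminant_comp, inv_mul_cancel_left₀ two_pi_I_ne_zero]

/-- The unit factor `∏ (1 - qⁿ)²⁴` of `Δ`. -/
noncomputable def discUnit (q : ℂ) : ℂ := ∏' i : ℕ, (1 - q ^ (i + 1)) ^ 24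

lemma discUnit_zero : discUnit 0 = 1 := by simp [discUnit]

lemma differentiableOn_discUnit : DifferentiableOn ℂ discUnit (Metric.ball 0 1) :=
  differentiableOn_tprod_one_sub_pow_pow 24

lemma analyticAt_discUnit : AnalyticAt ℂ discUnit 0 :=
  differentiableOn_discUnit.analyticAt (Metric.ball_mem_nhds 0 one_pos)

lemma cuspFunction_discriminant {q : ℂ} (hq : ‖q‖ < 1) :
    cuspFunction 1 discriminant q = q * discUnit q :=
  discriminant_cuspFunction_eqOn (by simpa using hq)

lemma discriminant_eq_qParam_mul (z : ℍ) : discriminant z =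
    Function.Periodic.qParam 1 (z : ℂ) * discUnit (Function.Periodic.qParam 1 (z : ℂ)) := by
  rw [← cuspFunction_discriminant (norm_qParam_lt_one' z), ← CuspForm.coe_discriminant]
  exact (SlashInvariantFormClass.eq_cuspFunction CuspForm.discriminant z one_mem_strictPeriods_SL
    one_ne_zero).symm

lemma tendsto_E2 : Tendsto EisensteinSeries.E2 atImInfty (𝓝 1) := by
  set q : ℍ → ℂ := fun z => Function.Periodic.qParam 1 (z : ℂ)
  have hq : Tendsto q atImInfty (𝓝 0) := qParam_tendsto_atImInfty one_pos
  have hne : ∀ z : ℍ, q z ≠ 0 := fun z => Function.Periodic.qParam_ne_zero _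
  have key : ∀ z : ℍ, EisensteinSeries.E2 z * discUnit (q z) =
      deriv (cuspFunction 1 discriminant) (q z) := by
    intro z
    have h1 := normalizedDeriv_eq CuspForm.discriminant z
    rw [CuspForm.coe_discriminant, D_discriminant, discriminant_eq_qParam_mul] at h1
    exact mul_left_cancel₀ (hne z) (by rw [← h1]; ring)
  have hu : Tendsto (fun z => discUnit (q z)) atImInfty (𝓝 1) := by
    have := analyticAt_discUnit.continuousAt.tendsto.comp hq
    rwa [discUnit_zero] at this
  have hd : deriv (cuspFunction 1 discriminant) 0 = 1 := by
    have := discriminant_qExpansion_coeff_one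
    simpa [qExpansion_coeff] using this
  have h2 : Tendsto (fun z => deriv (cuspFunction 1 discriminant) (q z)) atImInfty (𝓝 1) := by
    have := (ModularFormClass.analyticAt_cuspFunction_zero CuspForm.discriminant one_pos
      one_mem_strictPeriods_SL).deriv.continuousAt.tendsto.comp hq
    rwa [CuspForm.coe_discriminant, hd] at this
  have h3 := h2.div hu one_ne_zero
  rw [div_one] at h3
  refine h3.congr' ?_
  filter_upwards [hu.eventually_ne one_ne_zero] with z hz
  rw [Pi.div_apply, ← key, mul_div_cancel_right₀ _ hz]

lemma tendsto_E₄ : Tendsto E₄ atImInfty (𝓝 1) := by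
  have := tendsto_atImInfty_coeff_zero E₄
  rwa [EisensteinSeries.E_qExpansion_coeff_zero _ ⟨2, rfl⟩] at this

lemma tendsto_E₆ : Tendsto E₆ atImInfty (𝓝 1) := by
  have := tendsto_atImInfty_coeff_zero E₆
  rwa [EisensteinSeries.E_qExpansion_coeff_zero _ ⟨3, rfl⟩] at this

lemma tendsto_serreDerivative_E₄ :
    Tendsto (serreDerivative (4 : ℤ) E₄) atImInfty (𝓝 (-(1 / 3))) := by
  have h := (tendsto_normalizedDeriv E₄).sub ((tendsto_E2.const_mul (4 * 12⁻¹)).mul tendsto_E₄)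
  rwa [show (0 - 4 * 12⁻¹ * 1 * 1 : ℂ) = -(1 / 3) by norm_num] at h

/-- The Serre derivative of `E₄`, as a modular form of weight `6`. -/
noncomputable def serreE₄ : ModularForm 𝒮ℒ 6 :=
  levelOneForm (serreDerivative (4 : ℤ) E₄)
    (fun γ => serreDerivative_slash_invariant (k := 4) (ModularFormClass.holo E₄)
      (SlashInvariantFormClass.slash_action_eq E₄ _ ⟨γ, rfl⟩))
    (serreDerivative_mdifferentiable _ (ModularFormClass.holo E₄))
    (tendsto_serreDerivative_E₄.isBigO_one ℝ)

/-- Ramanujan's identity `D E₄ = (E₂ E₄ - E₆) / 3`: the Serre derivative of `E₄` lies in the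
one-dimensional space `M₆`. -/
lemma D_E₄ (z : ℍ) : D E₄ z = (EisensteinSeries.E2 z * E₄ z - E₆ z) / 3 := by
  have hne : E₆ ≠ 0 := by
    intro h
    have h1 := tendsto_E₆
    rw [h] at h1
    exact zero_ne_one (tendsto_nhds_unique tendsto_const_nhds h1)
  obtain ⟨c, hc⟩ := (finrank_eq_one_iff_of_nonzero' E₆ hne).mp
    (Module.rank_eq_one_iff_finrank_eq_one.mp levelOne_weight_six_rank_one) serreE₄
  have hc' : ∀ w, c * E₆ w = serreDerivative (4 : ℤ) E₄ w := fun w => DFunLike.congr_fun hc w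
  have h1 : c = -(1 / 3) := by
    have := tendsto_E₆.const_mul c
    rw [mul_one] at this
    exact tendsto_nhds_unique this (tendsto_serreDerivative_E₄.congr fun w => (hc' w).symm)
  have h2 := hc' z
  rw [h1, serreDerivative_apply] at h2
  push_cast at h2
  linear_combination -h2

lemma cuspFunction_E₄_zero : cuspFunction 1 E₄ 0 = 1 := by
  have := EisensteinSeries.E_qExpansion_coeff_zero (by norm_num : 3 ≤ 4) ⟨2, rfl⟩
  simpa [qExpansion_coeff] using this

lemma cuspFunction_E₆_zero : cuspFunction 1 E₆ 0 = 1 := by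
  have := EisensteinSeries.E_qExpansion_coeff_zero (by norm_num : 3 ≤ 6) ⟨3, rfl⟩
  simpa [qExpansion_coeff] using this

lemma analyticAt_cuspFunction_E₄ : AnalyticAt ℂ (cuspFunction 1 E₄) 0 :=
  ModularFormClass.analyticAt_cuspFunction_zero E₄ one_pos one_mem_strictPeriods_SL

lemma analyticAt_cuspFunction_E₆ : AnalyticAt ℂ (cuspFunction 1 E₆) 0 :=
  ModularFormClass.analyticAt_cuspFunction_zero E₆ one_pos one_mem_strictPeriods_SL

lemma cuspFunction_qParam {F : Type*} [FunLike F ℍ ℂ] {k : ℤ} [ModularFormClass F 𝒮ℒ k] (f : F)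
    (z : ℍ) : cuspFunction 1 f (Function.Periodic.qParam 1 (z : ℂ)) = f z :=
  SlashInvariantFormClass.eq_cuspFunction f z one_mem_strictPeriods_SL one_ne_zero

/-- The modular invariant `j = E₄³ / Δ`. -/
noncomputable def jInv (z : ℍ) : ℂ := E₄ z ^ 3 / discriminant z

lemma jInv_smul (γ : SL(2, ℤ)) (z : ℍ) : jInv (γ • z) = jInv z := by
  have h1 := modularForm_smul E₄ γ z
  have h2 := modularForm_smul CuspForm.discriminant γ z
  rw [CuspForm.coe_discriminant] at h2
  have hd := denom_ne_zero γ z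
  have hΔ := discriminant_ne_zero z
  rw [jInv, jInv, h1, h2]
  rw [show (12 : ℤ) = 4 * 3 by norm_num, zpow_mul]
  simp only [zpow_ofNat]
  field_simp

lemma jInv_sub (z : ℍ) : jInv z - 1728 = E₆ z ^ 2 / discriminant z := by
  have hΔ := discriminant_ne_zero z
  have h := discriminant_eq_E₄_cube_sub_E₆_sq z
  rw [jInv]
  field_simp
  linear_combination -1728 * h

lemma differentiableAt_comp_ofComplex {f : ℍ → ℂ} (hf : MDifferentiable 𝓘(ℂ) 𝓘(ℂ) f) (z : ℍ) :
    DifferentiableAt ℂ (f ∘ ofComplex) z :=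
  UpperHalfPlane.mdifferentiableAt_iff.mp (hf z)

lemma mdifferentiable_discriminant : MDifferentiable 𝓘(ℂ) 𝓘(ℂ) discriminant :=
  CuspForm.discriminant.holo'

lemma mdifferentiable_jInv : MDifferentiable 𝓘(ℂ) 𝓘(ℂ) jInv := by
  intro z
  rw [UpperHalfPlane.mdifferentiableAt_iff]
  exact ((differentiableAt_comp_ofComplex (ModularFormClass.holo E₄) z).pow 3).div
    (differentiableAt_comp_ofComplex mdifferentiable_discriminant z)
    (by simpa using discriminant_ne_zero z)

lemma D_jInv (z : ℍ) : D jInv z = -(E₄ z ^ 2 * E₆ z / discriminant z) := by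
  have h4 := (differentiableAt_comp_ofComplex (ModularFormClass.holo E₄) z).hasDerivAt
  have hD := (differentiableAt_comp_ofComplex mdifferentiable_discriminant z).hasDerivAt
  have hΔ := discriminant_ne_zero z
  have h := ((h4.pow 3).div hD (by simpa using hΔ)).deriv
  have e4 : deriv (E₄ ∘ ofComplex) z = 2 * Real.pi * I * D E₄ z := by
    rw [normalizedDerivOfComplex, mul_inv_cancel_left₀ two_pi_I_ne_zero]
  rw [D_E₄] at e4
  have hj : jInv ∘ ofComplex = (E₄ ∘ ofComplex) ^ 3 / (discriminant ∘ ofComplex) := rfl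
  rw [normalizedDerivOfComplex, hj, h, deriv_discriminant_comp, e4]
  have := two_pi_I_ne_zero
  simp only [Function.comp_apply, ofComplex_apply, Pi.pow_apply]
  field_simp
  norm_num
  ring

lemma deriv_jInv (z : ℍ) : deriv (jInv ∘ ofComplex) z =
    -(2 * Real.pi * I) * (E₄ z ^ 2 * E₆ z / discriminant z) := by
  have h := D_jInv z
  rw [normalizedDerivOfComplex, inv_mul_eq_iff_eq_mul₀ two_pi_I_ne_zero] at h
  rw [h]; ring

lemma tendsto_norm_jInv : Tendsto (fun z => ‖jInv z‖) atImInfty atTop := by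
  have h1 : Tendsto (fun z => ‖E₄ z ^ 3‖) atImInfty (𝓝 1) := by
    simpa using (tendsto_E₄.pow 3).norm
  have h2 : Tendsto (fun z => ‖discriminant z‖⁻¹) atImInfty atTop := by
    refine tendsto_inv_nhdsGT_zero.comp ?_
    rw [tendsto_nhdsWithin_iff]
    refine ⟨by simpa using discriminant_isZeroAtImInfty.norm, Eventually.of_forall fun z => ?_⟩
    exact norm_pos_iff.mpr (discriminant_ne_zero z)
  refine (h1.pos_mul_atTop one_pos h2).congr fun z => ?_
  rw [jInv, norm_div, div_eq_mul_inv]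

lemma E₆_I : E₆ UpperHalfPlane.I = 0 := by
  have h := modularForm_smul E₆ ModularGroup.S UpperHalfPlane.I
  have hS : ModularGroup.S • UpperHalfPlane.I = UpperHalfPlane.I :=
    ModularGroup.stabilizer_I.mpr (by simp)
  rw [hS, ModularGroup.denom_S, coe_I] at h
  have h6 : (I : ℂ) ^ (6 : ℤ) = -1 := by
    rw [show (6 : ℤ) = ((6 : ℕ) : ℤ) by norm_num, zpow_natCast, show 6 = 2 * 3 by norm_num, pow_mul,
      I_sq]
    norm_num
  rw [h6] at h
  have : 2 * E₆ UpperHalfPlane.I = 0 := by linear_combination h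
  simpa using this

lemma E₄_ρ : E₄ ρ = 0 := by
  have h := modularForm_smul E₄ (ModularGroup.S * ModularGroup.T) ρ
  have hS : (ModularGroup.S * ModularGroup.T) • ρ = ρ := ModularGroup.stabilizer_ρ.mpr (by simp)
  have hd : denom ((ModularGroup.S * ModularGroup.T : SL(2, ℤ))) ρ = (ρ : ℂ) + 1 := by
    rw [ModularGroup.denom_apply]
    simp [ModularGroup.coe_S, ModularGroup.coe_T]
  rw [hS, hd] at h
  have h4 : ((ρ : ℂ) + 1) ^ (4 : ℤ) = -ρ - 1 := by
    rw [show (4 : ℤ) = ((4 : ℕ) : ℤ) by norm_num, zpow_natCast]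
    linear_combination ((ρ : ℂ) ^ 2 + 3 * ρ + 2) * ρ_sq
  rw [h4] at h
  have hne : (ρ : ℂ) + 2 ≠ 0 := by
    intro h0
    have := congrArg Complex.re h0
    norm_num [ρ] at this
  exact (mul_eq_zero.mp (by linear_combination h : ((ρ : ℂ) + 2) * E₄ ρ = 0)).resolve_left hne

lemma jInv_I : jInv UpperHalfPlane.I = 1728 := by
  have := jInv_sub UpperHalfPlane.I
  rw [E₆_I] at this
  simpa [sub_eq_zero] using this

lemma jInv_ρ : jInv ρ = 0 := by simp [jInv, E₄_ρ]

end JInvariant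

/-! ### The modular invariant as a coordinate on the quotient -/

section Bijectivity

open Derivative ModularForm

lemma analyticAt_comp_ofComplex {f : ℍ → ℂ} (hf : MDifferentiable 𝓘(ℂ) 𝓘(ℂ) f) (z : ℍ) :
    AnalyticAt ℂ (f ∘ ofComplex) z :=
  (UpperHalfPlane.mdifferentiable_iff.mp hf).analyticAt
    (isOpen_upperHalfPlaneSet.mem_nhds z.coe_im_pos)

lemma isOpenMap_jInv : IsOpenMap jInv := by
  have han : AnalyticOnNhd ℂ (jInv ∘ ofComplex) upperHalfPlaneSet := fun w hw =>
    analyticAt_comp_ofComplex mdifferentiable_jInv ⟨w, hw⟩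
  have hpre : IsPreconnected upperHalfPlaneSet := (convex_halfSpace_im_gt 0).isPreconnected
  rcases han.is_constant_or_isOpen hpre with ⟨c, hc⟩ | h
  · exfalso
    have h1 := hc UpperHalfPlane.I UpperHalfPlane.I.coe_im_pos
    have h2 := hc ρ ρ.coe_im_pos
    rw [Function.comp_apply, ofComplex_apply, jInv_I] at h1
    rw [Function.comp_apply, ofComplex_apply, jInv_ρ] at h2
    rw [← h1] at h2
    norm_num at h2
  · intro U hU
    have hU' : IsOpen (UpperHalfPlane.coe '' U) := isOpenEmbedding_coe.isOpenMap U hU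
    have := h (UpperHalfPlane.coe '' U) (by rintro _ ⟨z, -, rfl⟩; exact z.coe_im_pos) hU'
    rw [Set.image_image] at this
    simpa using this

lemma continuous_jInv : Continuous jInv := mdifferentiable_jInv.continuous

/-- Points of the fundamental domain with bounded `j` lie in a truncated fundamental domain. -/
lemma exists_mem_truncatedFundamentalDomain (R : ℝ) : ∃ Y : ℝ, ∀ z ∈ ModularGroup.fd,
    ‖jInv z‖ ≤ R → z ∈ ModularGroup.truncatedFundamentalDomain Y := by
  have h := tendsto_norm_jInv.eventually (eventually_gt_atTop R)
  obtain ⟨Y, hY⟩ := (atImInfty_mem _).mp h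
  refine ⟨Y, fun z hz hR => ⟨hz, ?_⟩⟩
  by_contra hlt
  exact absurd (hY z (not_le.mp hlt).le) (not_lt.mpr hR)

lemma exists_mem_fd_jInv_eq (z : ℍ) :
    ∃ γ : SL(2, ℤ), γ • z ∈ ModularGroup.fd ∧ jInv (γ • z) = jInv z := by
  obtain ⟨γ, hγ⟩ := ModularGroup.exists_smul_mem_fd z
  exact ⟨γ, hγ, jInv_smul γ z⟩

lemma isClosed_range_jInv : IsClosed (Set.range jInv) := by
  rw [← closure_subset_iff_isClosed]
  intro r hr
  obtain ⟨Y, hY⟩ := exists_mem_truncatedFundamentalDomain (‖r‖ + 1)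
  have hK : IsClosed (jInv '' ModularGroup.truncatedFundamentalDomain Y) :=
    ((ModularGroup.isCompact_truncatedFundamentalDomain Y).image continuous_jInv).isClosed
  refine Set.image_subset_range jInv (ModularGroup.truncatedFundamentalDomain Y) ?_
  rw [← hK.closure_eq]
  rw [mem_closure_iff_nhds] at hr ⊢
  intro t ht
  have hb : Metric.ball r 1 ∈ 𝓝 r := Metric.ball_mem_nhds r one_pos
  obtain ⟨s, ⟨hst, hsb⟩, z, rfl⟩ := hr _ (inter_mem ht hb)
  obtain ⟨γ, hγ, hj⟩ := exists_mem_fd_jInv_eq z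
  refine ⟨jInv z, hst, γ • z, hY _ hγ ?_, hj⟩
  rw [hj]
  have := norm_le_norm_add_norm_sub' (jInv z) r
  rw [Metric.mem_ball, dist_eq_norm] at hsb
  linarith

/-- The range of `j` is open and closed. -/
lemma surjective_jInv : Function.Surjective jInv := by
  have h : IsClopen (Set.range jInv) :=
    ⟨isClosed_range_jInv, isOpenMap_jInv.isOpen_range⟩
  rw [← Set.range_eq_univ]
  exact h.eq_univ ⟨_, Set.mem_range_self UpperHalfPlane.I⟩

/-- A function with nonzero strict derivative is locally injective. -/
lemma _root_.HasStrictDerivAt.exists_injOn {f : ℂ → ℂ} {f' a : ℂ} (h : HasStrictDerivAt f f' a)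
    (hf' : f' ≠ 0) : ∃ U ∈ 𝓝 a, Set.InjOn f U := by
  have := (h.hasStrictFDerivAt_equiv hf').eventually_left_inverse
  refine ⟨_, this, fun x hx y hy hxy => ?_⟩
  rw [← hx.out, ← hy.out, hxy]

lemma exists_injOn_jInv {z : ℍ} (h4 : E₄ z ≠ 0) (h6 : E₆ z ≠ 0) :
    ∃ U ∈ 𝓝 z, Set.InjOn jInv U := by
  have h1 := (analyticAt_comp_ofComplex mdifferentiable_jInv z).hasStrictDerivAt
  have h2 : deriv (jInv ∘ ofComplex) z ≠ 0 := by
    rw [deriv_jInv]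
    exact mul_ne_zero (neg_ne_zero.mpr two_pi_I_ne_zero)
      (div_ne_zero (mul_ne_zero (pow_ne_zero 2 h4) h6) (discriminant_ne_zero z))
  obtain ⟨U, hU, hinj⟩ := h1.exists_injOn h2
  refine ⟨UpperHalfPlane.coe ⁻¹' U, continuous_coe.continuousAt hU, fun x hx y hy hxy => ?_⟩
  exact UpperHalfPlane.ext (hinj hx hy (by simpa using hxy))

/-- Near `i∞` the function `j` is injective modulo translations. -/
lemma exists_jInv_injective_at_infty : ∃ Y : ℝ, ∀ z w : ℍ, Y ≤ z.im → Y ≤ w.im →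
    jInv z = jInv w → ∃ γ : SL(2, ℤ), γ • z = w := by
  -- `1 / j` is an analytic function of `q` with a simple zero at `q = 0`
  set φ : ℂ → ℂ := fun q => q * (discUnit q / cuspFunction 1 E₄ q ^ 3)
  have hu : AnalyticAt ℂ (fun q => discUnit q / cuspFunction 1 E₄ q ^ 3) 0 :=
    analyticAt_discUnit.div (analyticAt_cuspFunction_E₄.pow 3) (by simp [cuspFunction_E₄_zero])
  have hφ : AnalyticAt ℂ φ 0 := analyticAt_id.mul hu
  have hd : deriv φ 0 = 1 := by
    have h1 : HasDerivAt φ _ 0 := (hasDerivAt_id (0 : ℂ)).fun_mul hu.differentiableAt.hasDerivAt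
    rw [h1.deriv]
    simp [cuspFunction_E₄_zero, discUnit_zero]
  obtain ⟨U, hU, hinj⟩ := hφ.hasStrictDerivAt.exists_injOn (by rw [hd]; exact one_ne_zero)
  obtain ⟨Y, hY⟩ := (atImInfty_mem _).mp ((qParam_tendsto_atImInfty one_pos) hU)
  refine ⟨Y, fun z w hz hw hzw => ?_⟩
  have hjφ : ∀ z : ℍ, (jInv z)⁻¹ = φ (Function.Periodic.qParam 1 z) := by
    intro z
    simp only [φ, jInv, cuspFunction_qParam, discriminant_eq_qParam_mul, inv_div, mul_div_assoc]
  have hq : Function.Periodic.qParam 1 (z : ℂ) = Function.Periodic.qParam 1 (w : ℂ) :=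
    hinj (hY z hz) (hY w hw) (by rw [← hjφ, ← hjφ, hzw])
  simp only [Function.Periodic.qParam] at hq
  obtain ⟨n, hn⟩ := Complex.exp_eq_exp_iff_exists_int.mp hq
  refine ⟨ModularGroup.T ^ (-n), UpperHalfPlane.ext ?_⟩
  rw [ModularGroup.coe_T_zpow_smul_eq]
  have h2 : (2 * Real.pi * I : ℂ) * (z - w - n) = 0 := by
    simp only [ofReal_one, div_one] at hn
    linear_combination hn
  have h3 := (mul_eq_zero.mp h2).resolve_left two_pi_I_ne_zero
  push_cast
  linear_combination h3

instance : ProperlyDiscontinuousSMul SL(2, ℤ) ℍ where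
  finite_disjoint_inter_image {K L} hK hL := by
    have h := ProperlyDiscontinuousSMul.finite_disjoint_inter_image (Γ := 𝒮ℒ) hK hL
    let ι : SL(2, ℤ) → 𝒮ℒ := fun γ => ⟨γ, γ, rfl⟩
    have hι : Function.Injective ι := fun a b hab =>
      Matrix.SpecialLinearGroup.mapGL_injective (congrArg Subtype.val hab)
    exact (h.preimage hι.injOn).subset fun γ hγ => hγ

instance : ContinuousConstSMul SL(2, ℤ) ℍ where
  continuous_const_smul γ :=
    continuous_const_smul (γ : GL (Fin 2) ℝ)

/-- Values of `j` attained on at least two orbits. It turns out that there are none. -/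
def badValues : Set ℂ :=
  {r | ∃ z w : ℍ, jInv z = r ∧ jInv w = r ∧ ¬ ∃ γ : SL(2, ℤ), γ • z = w}

/-- The quotient `SL₂(ℤ) \ ℍ` is Hausdorff and `j` is open, so two orbits with the same value can be
separated by open sets with intersecting images. -/
lemma isOpen_badValues : IsOpen badValues := by
  rw [isOpen_iff_mem_nhds]
  rintro r ⟨z, w, hz, hw, hzw⟩
  let π : ℍ → MulAction.orbitRel.Quotient SL(2, ℤ) ℍ := Quotient.mk _
  have hπ : ∀ x y : ℍ, π x = π y ↔ ∃ γ : SL(2, ℤ), γ • x = y := fun x y => by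
    rw [eq_comm]
    exact Quotient.eq.trans MulAction.orbitRel_apply
  have hcont : Continuous π := continuous_quot_mk
  have : T2Space (MulAction.orbitRel.Quotient SL(2, ℤ) ℍ) :=
    t2Space_of_properlyDiscontinuousSMul_of_t2Space
  have hne : π z ≠ π w := fun h => hzw ((hπ _ _).mp h)
  obtain ⟨U, V, hU, hV, hzU, hwV, hUV⟩ := t2_separation hne
  have h1 : jInv '' (π ⁻¹' U) ∈ 𝓝 r := hz ▸
    isOpenMap_jInv.image_mem_nhds ((hU.preimage hcont).mem_nhds hzU)
  have h2 : jInv '' (π ⁻¹' V) ∈ 𝓝 r := hw ▸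
    isOpenMap_jInv.image_mem_nhds ((hV.preimage hcont).mem_nhds hwV)
  filter_upwards [h1, h2]
  rintro s ⟨x, hx, hxs⟩ ⟨y, hy, hys⟩
  refine ⟨x, y, hxs, hys, fun h => ?_⟩
  have := (hπ _ _).mpr h
  exact Set.disjoint_left.mp hUV hx (by rw [Set.mem_preimage] at hy; rwa [this])

/-- Away from the values `0` and `1728`, where `j` is locally injective, the set of values
attained on two orbits is closed. -/
lemma mem_badValues_of_mem_closure {r : ℂ} (hr : r ∈ closure badValues) (h0 : r ≠ 0)
    (h1728 : r ≠ 1728) : r ∈ badValues := by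
  obtain ⟨s, hs, hsr⟩ := mem_closure_iff_seq_limit.mp hr
  obtain ⟨Y, hY⟩ := exists_mem_truncatedFundamentalDomain (‖r‖ + 1)
  set K := ModularGroup.truncatedFundamentalDomain Y
  have hK : IsCompact K := ModularGroup.isCompact_truncatedFundamentalDomain Y
  have hpair : ∀ n, ∃ p : ℍ × ℍ, p.1 ∈ ModularGroup.fd ∧ p.2 ∈ ModularGroup.fd ∧
      jInv p.1 = s n ∧ jInv p.2 = s n ∧ ¬ ∃ γ : SL(2, ℤ), γ • p.1 = p.2 := by
    intro n
    obtain ⟨z, w, hz, hw, hzw⟩ := hs n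
    obtain ⟨γ, hγ, hγj⟩ := exists_mem_fd_jInv_eq z
    obtain ⟨δ, hδ, hδj⟩ := exists_mem_fd_jInv_eq w
    refine ⟨(γ • z, δ • w), hγ, hδ, hγj.trans hz, hδj.trans hw, ?_⟩
    rintro ⟨α, hα⟩
    refine hzw ⟨δ⁻¹ * α * γ, ?_⟩
    rw [mul_smul, mul_smul, hα, inv_smul_smul]
  choose p hp1 hp2 hj1 hj2 hp using hpair
  have hev : ∀ᶠ n in atTop, p n ∈ K ×ˢ K := by
    have hb : ∀ᶠ n in atTop, ‖s n‖ ≤ ‖r‖ + 1 :=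
      (hsr.norm.eventually (eventually_lt_nhds (lt_add_one ‖r‖))).mono fun n hn => le_of_lt hn
    filter_upwards [hb] with n hn
    exact ⟨hY _ (hp1 n) (by rwa [hj1]), hY _ (hp2 n) (by rwa [hj2])⟩
  obtain ⟨⟨z, w⟩, -, φ, hφ, hlim⟩ := (hK.prod hK).tendsto_subseq' hev.frequently
  have hlim1 : Tendsto (fun n => (p (φ n)).1) atTop (𝓝 z) := hlim.fst_nhds
  have hlim2 : Tendsto (fun n => (p (φ n)).2) atTop (𝓝 w) := hlim.snd_nhds
  have hsφ : Tendsto (fun n => s (φ n)) atTop (𝓝 r) := hsr.comp hφ.tendsto_atTop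
  have hz : jInv z = r := tendsto_nhds_unique
    (((continuous_jInv.tendsto z).comp hlim1).congr fun n => hj1 _) hsφ
  have hw : jInv w = r := tendsto_nhds_unique
    (((continuous_jInv.tendsto w).comp hlim2).congr fun n => hj2 _) hsφ
  refine ⟨z, w, hz, hw, ?_⟩
  rintro ⟨γ, hγ⟩
  have h4 : E₄ z ≠ 0 := fun h => h0 (by rw [← hz, jInv, h]; simp)
  have h6 : E₆ z ≠ 0 := fun h => h1728 (by
    have := jInv_sub z
    rw [h] at this
    rw [← hz]
    simpa [sub_eq_zero] using this)
  obtain ⟨U, hU, hinj⟩ := exists_injOn_jInv h4 h6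
  have hlim2' : Tendsto (fun n => γ⁻¹ • (p (φ n)).2) atTop (𝓝 z) := by
    have := hlim2.const_smul γ⁻¹
    rwa [← hγ, inv_smul_smul] at this
  obtain ⟨n, hn1, hn2⟩ := ((hlim1.eventually_mem hU).and (hlim2'.eventually_mem hU)).exists
  refine hp (φ n) ⟨γ, ?_⟩
  have : (p (φ n)).1 = γ⁻¹ • (p (φ n)).2 :=
    hinj hn1 hn2 (by rw [jInv_smul, hj1, hj2])
  rw [this, smul_inv_smul]

/-- Values of large modulus are attained only near `i∞`, where `j` is injective modulo translations. -/
lemma exists_notMem_badValues : ∃ r : ℂ, r ≠ 0 ∧ r ≠ 1728 ∧ r ∉ badValues := by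
  obtain ⟨Y, hY⟩ := exists_jInv_injective_at_infty
  obtain ⟨M, hM⟩ := ((ModularGroup.isCompact_truncatedFundamentalDomain Y).image
    continuous_jInv).isBounded.exists_norm_le
  set t : ℝ := max M 1728 + 1
  have ht1 : 1728 < t := lt_of_le_of_lt (le_max_right M 1728) (lt_add_one _)
  have ht2 : M < t := lt_of_le_of_lt (le_max_left M 1728) (lt_add_one _)
  have him : ∀ z ∈ ModularGroup.fd, jInv z = t → Y ≤ z.im := by
    intro z hz hj
    by_contra hlt
    have h1 := hM (jInv z) ⟨z, ⟨hz, (not_le.mp hlt).le⟩, rfl⟩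
    rw [hj, norm_real, Real.norm_of_nonneg (by linarith)] at h1
    linarith
  refine ⟨t, ?_, ?_, ?_⟩
  · exact_mod_cast (by linarith : t ≠ 0)
  · exact_mod_cast ht1.ne'
  · rintro ⟨z, w, hz, hw, hzw⟩
    obtain ⟨γ, hγ, hγj⟩ := exists_mem_fd_jInv_eq z
    obtain ⟨δ, hδ, hδj⟩ := exists_mem_fd_jInv_eq w
    obtain ⟨α, hα⟩ := hY (γ • z) (δ • w) (him _ hγ (hγj.trans hz)) (him _ hδ (hδj.trans hw))
      (by rw [hγj, hδj, hz, hw])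
    refine hzw ⟨δ⁻¹ * α * γ, ?_⟩
    rw [mul_smul, mul_smul, hα, inv_smul_smul]

lemma badValues_eq_empty : badValues = ∅ := by
  have hc : ({0, 1728} : Set ℂ).Countable := (Set.toFinite _).countable
  have hrank : 1 < Module.rank ℝ ℂ := by simp
  have hconn := (hc.isConnected_compl_of_one_lt_rank hrank).isPreconnected
  have hdisj : ¬ (({0, 1728} : Set ℂ)ᶜ ∩ badValues).Nonempty := by
    intro hne
    have hsub := hconn.subset_of_closure_inter_subset isOpen_badValues hne (by
      rintro r ⟨hr, hr'⟩
      simp only [Set.mem_compl_iff, Set.mem_insert_iff, Set.mem_singleton_iff, not_or] at hr'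
      exact mem_badValues_of_mem_closure hr hr'.1 hr'.2)
    obtain ⟨r, h0, h1, hr⟩ := exists_notMem_badValues
    exact hr (hsub (by simp [h0, h1]))
  by_contra hne
  have hd : Dense ({0, 1728} : Set ℂ)ᶜ := hc.dense_compl ℝ
  have := hd.inter_open_nonempty _ isOpen_badValues (Set.nonempty_iff_ne_empty.mpr hne)
  rw [Set.inter_comm] at this
  exact hdisj this

/-- `j` separates the orbits of `SL₂(ℤ)`. -/
lemma exists_smul_eq_of_jInv_eq {z w : ℍ} (h : jInv z = jInv w) : ∃ γ : SL(2, ℤ), γ • z = w := by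
  by_contra hne
  have : jInv w ∈ badValues := ⟨z, w, h, rfl, hne⟩
  rw [badValues_eq_empty] at this
  exact this

/-- `j` as a function on `SL₂(ℤ) \ ℍ`. -/
noncomputable def jQuot : MulAction.orbitRel.Quotient SL(2, ℤ) ℍ → ℂ :=
  fun p => jInv (Quotient.out p)

lemma bijective_jQuot : Function.Bijective jQuot := by
  have hout : ∀ p : MulAction.orbitRel.Quotient SL(2, ℤ) ℍ, Quotient.mk _ (Quotient.out p) = p :=
    Quotient.out_eq
  constructor
  · intro p p' h
    obtain ⟨γ, hγ⟩ := exists_smul_eq_of_jInv_eq h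
    rw [← hout p, ← hout p']
    exact (Quotient.sound (s := MulAction.orbitRel SL(2, ℤ) ℍ)
      (MulAction.orbitRel_apply.mpr ⟨γ, hγ⟩)).symm
  · intro r
    obtain ⟨z, rfl⟩ := surjective_jInv r
    refine ⟨Quotient.mk _ z, ?_⟩
    have h := Quotient.eq.mp (hout (Quotient.mk _ z))
    obtain ⟨γ, hγ⟩ := MulAction.orbitRel_apply.mp h
    rw [jQuot, ← hγ]
    exact jInv_smul γ z

/-! ### Ramification of `j` -/

lemma card_stabilizer_smul (γ : SL(2, ℤ)) (z : ℍ) :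
    Nat.card (MulAction.stabilizer SL(2, ℤ) (γ • z)) =
      Nat.card (MulAction.stabilizer SL(2, ℤ) z) :=
  Nat.card_congr (MulAction.stabilizerEquivStabilizer (g := γ) rfl).symm.toEquiv

lemma card_stabilizer_of_forall {z : ℍ} (s : Finset SL(2, ℤ))
    (h : ∀ g : SL(2, ℤ), g • z = z ↔ g ∈ s) :
    Nat.card (MulAction.stabilizer SL(2, ℤ) z) = s.card := by
  have : ((MulAction.stabilizer SL(2, ℤ) z : Subgroup SL(2, ℤ)) : Set SL(2, ℤ)) = s := by
    ext g
    simpa [MulAction.mem_stabilizer_iff] using h g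
  rw [← Set.ncard_coe_finset, ← this]
  rfl

lemma card_stabilizer_I : Nat.card (MulAction.stabilizer SL(2, ℤ) UpperHalfPlane.I) = 4 := by
  rw [card_stabilizer_of_forall _ fun g => ModularGroup.stabilizer_I]
  decide

lemma card_stabilizer_ρ : Nat.card (MulAction.stabilizer SL(2, ℤ) ρ) = 6 := by
  rw [card_stabilizer_of_forall _ fun g => ModularGroup.stabilizer_ρ]
  decide

lemma card_stabilizer_of_E₄_eq_zero {z : ℍ} (h : E₄ z = 0) :
    Nat.card (MulAction.stabilizer SL(2, ℤ) z) = 6 := by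
  obtain ⟨γ, hγ⟩ := exists_smul_eq_of_jInv_eq (z := ρ) (w := z) (by rw [jInv_ρ, jInv, h]; simp)
  rw [← hγ, card_stabilizer_smul, card_stabilizer_ρ]

lemma card_stabilizer_of_E₆_eq_zero {z : ℍ} (h : E₆ z = 0) :
    Nat.card (MulAction.stabilizer SL(2, ℤ) z) = 4 := by
  obtain ⟨γ, hγ⟩ := exists_smul_eq_of_jInv_eq (z := UpperHalfPlane.I) (w := z) (by
    have := jInv_sub z
    rw [jInv_I, eq_comm, ← sub_eq_zero, this, h]; simp)
  rw [← hγ, card_stabilizer_smul, card_stabilizer_I]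

lemma card_stabilizer_of_ne_zero {z : ℍ} (h4 : E₄ z ≠ 0) (h6 : E₆ z ≠ 0) :
    Nat.card (MulAction.stabilizer SL(2, ℤ) z) = 2 := by
  obtain ⟨γ, hγ⟩ := ModularGroup.exists_smul_mem_fd z
  have h4' : E₄ (γ • z) ≠ 0 := by
    rw [modularForm_smul]; exact mul_ne_zero (zpow_ne_zero _ (denom_ne_zero _ _)) h4
  have h6' : E₆ (γ • z) ≠ 0 := by
    rw [modularForm_smul]; exact mul_ne_zero (zpow_ne_zero _ (denom_ne_zero _ _)) h6
  rw [← card_stabilizer_smul γ z, card_stabilizer_of_forall {1, -1}]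
  · decide
  · intro g
    constructor
    · intro hg
      have h1 : γ • z ≠ UpperHalfPlane.I := fun h => h6' (h ▸ E₆_I)
      have h2 : γ • z ≠ ρ := fun h => h4' (h ▸ E₄_ρ)
      have h3 : γ • z ≠ (1 : ℝ) +ᵥ ρ := fun h => h4' (by
        rw [h, ← modular_T_smul, modularForm_smul, E₄_ρ, mul_zero])
      simpa using ModularGroup.stabilizer_of_ne hγ hg h1 h2 h3
    · intro hg
      rcases Finset.mem_insert.mp hg with rfl | hg
      · exact one_smul _ _
      · rw [Finset.mem_singleton.mp hg, ModularGroup.SL_neg_smul, one_smul]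

/-- The ramification index of `j` at `z` is half the order of the stabilizer. It follows by
comparing the orders of `j`, `j - 1728` and `j'` in terms of those of `E₄` and `E₆`. -/
lemma exists_order_jInv_sub (z : ℍ) : ∃ e : ℕ, 0 < e ∧
    Nat.card (MulAction.stabilizer SL(2, ℤ) z) = 2 * e ∧
    meromorphicOrderAt (fun w => (jInv ∘ ofComplex) w - jInv z) z = ((e : ℤ) : WithTop ℤ) := by
  set x : ℂ := UpperHalfPlane.coe z with hx
  set J : ℂ → ℂ := fun w => (jInv ∘ ofComplex) w - jInv z
  set f4 : ℂ → ℂ := E₄ ∘ ofComplex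
  set f6 : ℂ → ℂ := E₆ ∘ ofComplex
  set fΔ : ℂ → ℂ := discriminant ∘ ofComplex
  have a4 : AnalyticAt ℂ f4 x := analyticAt_comp_ofComplex (ModularFormClass.holo E₄) z
  have a6 : AnalyticAt ℂ f6 x := analyticAt_comp_ofComplex (ModularFormClass.holo E₆) z
  have aΔ : AnalyticAt ℂ fΔ x := analyticAt_comp_ofComplex mdifferentiable_discriminant z
  have aJ : AnalyticAt ℂ J x :=
    (analyticAt_comp_ofComplex mdifferentiable_jInv z).sub analyticAt_const
  have v4 : f4 x = E₄ z := by simp [f4, x]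
  have v6 : f6 x = E₆ z := by simp [f6, x]
  have vΔ : fΔ x ≠ 0 := by simpa [fΔ, x] using discriminant_ne_zero z
  have oΔ : meromorphicOrderAt fΔ⁻¹ x = 0 := by
    rw [meromorphicOrderAt_inv, (aΔ.meromorphicNFAt.meromorphicOrderAt_eq_zero_iff).mpr vΔ, neg_zero]
  -- the order `n` of `j - j(z)` is finite and positive
  have hJ0 : J x = 0 := by simp [J, x]
  have hfin : meromorphicOrderAt J x ≠ ⊤ := by
    intro htop
    rw [meromorphicOrderAt_eq_top_iff] at htop
    have hev : ∀ᶠ w in 𝓝 x, J w = 0 := by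
      rw [eventually_nhdsWithin_iff] at htop
      filter_upwards [htop] with w hw
      by_cases h : w = x
      · rw [h, hJ0]
      · exact hw h
    have hev' : ∀ᶠ w in 𝓝 z, jInv w = jInv z := by
      filter_upwards [continuous_coe.continuousAt hev] with w hw
      simpa [J, sub_eq_zero] using hw
    have h1 := isOpenMap_jInv.image_mem_nhds hev'
    have h2 : ({jInv z} : Set ℂ) ∈ 𝓝 (jInv z) :=
      mem_of_superset h1 (by rintro _ ⟨w, hw, rfl⟩; exact hw)
    exact (infinite_of_mem_nhds _ h2) (Set.finite_singleton _)
  obtain ⟨m, hm⟩ := WithTop.ne_top_iff_exists.mp hfin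
  have hmpos : 0 < m := by
    have h1 : 0 ≤ meromorphicOrderAt J x := aJ.meromorphicOrderAt_nonneg
    have h2 : meromorphicOrderAt J x ≠ 0 := fun h =>
      (aJ.meromorphicNFAt.meromorphicOrderAt_eq_zero_iff.mp h) hJ0
    rw [← hm] at h1 h2
    exact lt_of_le_of_ne (by exact_mod_cast h1) (by exact_mod_cast h2.symm)
  -- the order of `j'`
  have hd1 : meromorphicOrderAt (deriv J) x = ((m - 1 : ℤ) : WithTop ℤ) :=
    meromorphicOrderAt_deriv_eq_sub_one (by exact_mod_cast hmpos.ne') hm.symm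
  have hd2 : meromorphicOrderAt (deriv J) x =
      2 * meromorphicOrderAt f4 x + meromorphicOrderAt f6 x := by
    have hev : deriv J =ᶠ[𝓝 x] (fun _ => -(2 * Real.pi * I)) * (f4 ^ 2 * f6 * fΔ⁻¹) := by
      filter_upwards [isOpen_upperHalfPlaneSet.mem_nhds z.coe_im_pos] with w hw
      have h1 := deriv_jInv ⟨w, hw⟩
      have h2 : deriv J w = deriv (jInv ∘ ofComplex) w := deriv_sub_const _
      rw [h2]
      simpa [f4, f6, fΔ, ofComplex_apply_of_im_pos hw, div_eq_mul_inv] using h1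
    have hc : AnalyticAt ℂ (fun _ : ℂ => -(2 * Real.pi * I : ℂ)) x := analyticAt_const
    rw [meromorphicOrderAt_congr (hev.filter_mono nhdsWithin_le_nhds),
      meromorphicOrderAt_mul hc.meromorphicAt
        (((a4.meromorphicAt.pow 2).mul a6.meromorphicAt).mul aΔ.meromorphicAt.inv),
      meromorphicOrderAt_mul ((a4.meromorphicAt.pow 2).mul a6.meromorphicAt) aΔ.meromorphicAt.inv,
      meromorphicOrderAt_mul (a4.meromorphicAt.pow 2) a6.meromorphicAt,
      meromorphicOrderAt_pow a4.meromorphicAt, oΔ,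
      hc.meromorphicNFAt.meromorphicOrderAt_eq_zero_iff.mpr (neg_ne_zero.mpr two_pi_I_ne_zero)]
    simp
  rw [hd1] at hd2
  have hU := isOpen_upperHalfPlaneSet.mem_nhds z.coe_im_pos
  by_cases h4 : E₄ z = 0
  · have h6 : E₆ z ≠ 0 := by
      intro h6
      have := discriminant_eq_E₄_cube_sub_E₆_sq z
      rw [h4, h6] at this
      exact discriminant_ne_zero z (by rw [this]; norm_num)
    have o6 : meromorphicOrderAt f6 x = 0 :=
      a6.meromorphicNFAt.meromorphicOrderAt_eq_zero_iff.mpr (by rwa [v6])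
    have o3 : meromorphicOrderAt J x = 3 * meromorphicOrderAt f4 x := by
      have hev : J =ᶠ[𝓝 x] f4 ^ 3 * fΔ⁻¹ := by
        filter_upwards [hU] with w hw
        have : jInv z = 0 := by rw [jInv, h4]; simp
        simp only [J, this, sub_zero]
        simp [jInv, f4, fΔ, div_eq_mul_inv]
      rw [meromorphicOrderAt_congr (hev.filter_mono nhdsWithin_le_nhds),
        meromorphicOrderAt_mul (a4.meromorphicAt.pow 3) aΔ.meromorphicAt.inv,
        meromorphicOrderAt_pow a4.meromorphicAt, oΔ]
      simp
    refine ⟨3, by norm_num, card_stabilizer_of_E₄_eq_zero h4, ?_⟩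
    rw [o6] at hd2
    rw [← hm] at o3 ⊢
    induction h : meromorphicOrderAt f4 x using WithTop.recTopCoe with
    | top => rw [h] at o3; exact absurd o3 (by simp)
    | coe l =>
      rw [h] at o3 hd2
      have e3 : m = 3 * l := WithTop.coe_injective (o3.trans (WithTop.coe_mul 3 l).symm)
      have e2 : m - 1 = 2 * l + 0 := WithTop.coe_injective hd2
      norm_cast
      lia
  by_cases h6 : E₆ z = 0
  · have o4 : meromorphicOrderAt f4 x = 0 :=
      a4.meromorphicNFAt.meromorphicOrderAt_eq_zero_iff.mpr (by rwa [v4])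
    have o3 : meromorphicOrderAt J x = 2 * meromorphicOrderAt f6 x := by
      have hev : J =ᶠ[𝓝 x] f6 ^ 2 * fΔ⁻¹ := by
        filter_upwards [hU] with w hw
        have h1 : jInv z = 1728 := by
          have := jInv_sub z
          rw [h6] at this
          simpa [sub_eq_zero] using this
        simp [J, h1, jInv_sub, f6, fΔ, div_eq_mul_inv]
      rw [meromorphicOrderAt_congr (hev.filter_mono nhdsWithin_le_nhds),
        meromorphicOrderAt_mul (a6.meromorphicAt.pow 2) aΔ.meromorphicAt.inv,
        meromorphicOrderAt_pow a6.meromorphicAt, oΔ]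
      simp
    refine ⟨2, by norm_num, card_stabilizer_of_E₆_eq_zero h6, ?_⟩
    rw [o4] at hd2
    rw [← hm] at o3 ⊢
    induction h : meromorphicOrderAt f6 x using WithTop.recTopCoe with
    | top => rw [h] at o3; exact absurd o3 (by simp)
    | coe l =>
      rw [h] at o3 hd2
      have e3 : m = 2 * l := WithTop.coe_injective (o3.trans (WithTop.coe_mul 2 l).symm)
      have e2 : m - 1 = 2 * 0 + l := WithTop.coe_injective hd2
      norm_cast
      lia
  · have o4 : meromorphicOrderAt f4 x = 0 :=
      a4.meromorphicNFAt.meromorphicOrderAt_eq_zero_iff.mpr (by rwa [v4])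
    have o6 : meromorphicOrderAt f6 x = 0 :=
      a6.meromorphicNFAt.meromorphicOrderAt_eq_zero_iff.mpr (by rwa [v6])
    refine ⟨1, by norm_num, card_stabilizer_of_ne_zero h4 h6, ?_⟩
    rw [o4, o6] at hd2
    rw [← hm]
    have e2 : m - 1 = 2 * 0 + 0 := WithTop.coe_injective hd2
    norm_cast
    lia

end Bijectivity

/-! ### Faber polynomials and their generating function -/

section Faber

open Polynomial

/-- Taylor's formula with an analytic remainder. -/
lemma _root_.HasFPowerSeriesAt.exists_eq_sum_add {f : ℂ → ℂ} {p : FormalMultilinearSeries ℂ ℂ ℂ}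
    (hf : HasFPowerSeriesAt f p 0) (n : ℕ) : ∃ h : ℂ → ℂ, AnalyticAt ℂ h 0 ∧
      ∀ q, f q = ∑ m ∈ Finset.range n, p.coeff m * q ^ m + q ^ n * h q := by
  induction n generalizing f p with
  | zero => exact ⟨f, hf.analyticAt, by simp⟩
  | succ n ih =>
    obtain ⟨h, hh, hq⟩ := ih hf.has_fpower_series_dslope_fslope
    refine ⟨h, hh, fun q => ?_⟩
    have h1 := sub_smul_dslope f 0 q
    rw [hq, smul_eq_mul, sub_zero] at h1
    have h2 : p.coeff 0 = f 0 := hf.coeff_zero _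
    rw [Finset.sum_range_succ']
    simp only [FormalMultilinearSeries.coeff_fslope] at h1
    have h3 : ∑ m ∈ Finset.range n, p.coeff (m + 1) * q ^ (m + 1) =
        q * ∑ m ∈ Finset.range n, p.coeff (m + 1) * q ^ m := by
      rw [Finset.mul_sum]
      exact Finset.sum_congr rfl fun m _ => by ring
    rw [h2, h3]
    linear_combination -h1

/-- If `J = P(q) / q` has a simple pole with residue `1` at `q = 0`, then there are polynomials
`pₙ` in `J` with principal part `q⁻ⁿ` and vanishing constant term (constant term `1` if `n = 0`):
the Faber polynomials of `J`. -/
lemma exists_faber {P : ℂ → ℂ} (hP : AnalyticAt ℂ P 0) (hP0 : P 0 = 1) (n : ℕ) :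
    ∃ p : ℂ[X], ∃ h : ℂ → ℂ, AnalyticAt ℂ h 0 ∧
      ∀ q ≠ 0, p.eval (P q / q) = (q ^ n)⁻¹ + q * h q := by
  induction n using Nat.strong_induction_on with
  | _ n ih =>
    choose! p h hh hp using ih
    obtain ⟨s, hs⟩ := hP.pow n
    obtain ⟨g, hg, hgq⟩ := hs.exists_eq_sum_add (n + 1)
    have hs0 : s.coeff 0 = 1 := by
      have : s.coeff 0 = (P ^ n) 0 := hs.coeff_zero _
      simpa [hP0] using this
    refine ⟨X ^ n - ∑ m ∈ Finset.range n, C (s.coeff (m + 1)) * p (n - (m + 1)),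
      fun q => g q - ∑ m ∈ Finset.range n, s.coeff (m + 1) * h (n - (m + 1)) q, ?_, fun q hq => ?_⟩
    · refine hg.fun_sub (Finset.analyticAt_fun_sum _ fun m hm => ?_)
      exact analyticAt_const.fun_mul (hh _ (by have := Finset.mem_range.mp hm; lia))
    · have h1 := hgq q
      rw [Pi.pow_apply, Finset.sum_range_succ', hs0] at h1
      simp only [eval_sub, eval_pow, eval_X, eval_finsetSum, eval_mul, eval_C, div_pow, h1]
      have h2 : ∀ m ∈ Finset.range n, s.coeff (m + 1) * (p (n - (m + 1))).eval (P q / q) =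
          s.coeff (m + 1) * q ^ (m + 1) / q ^ n + q * (s.coeff (m + 1) * h (n - (m + 1)) q) := by
        intro m hm
        have hm' := Finset.mem_range.mp hm
        have h3 : q ^ n = q ^ (n - (m + 1)) * q ^ (m + 1) := by rw [← pow_add]; congr 1; lia
        rw [hp _ (by lia) q hq, h3]
        field_simp
      rw [Finset.sum_congr rfl h2, Finset.sum_add_distrib, ← Finset.sum_div, ← Finset.mul_sum]
      field_simp
      ring

lemma _root_.Polynomial.exists_derivative_eq (Q : ℂ[X]) : ∃ S : ℂ[X], derivative S = Q := by
  induction Q using Polynomial.induction_on' with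
  | add p q hp hq =>
    obtain ⟨S, rfl⟩ := hp
    obtain ⟨T, rfl⟩ := hq
    exact ⟨S + T, derivative_add⟩
  | monomial n a =>
    refine ⟨monomial (n + 1) (a / (n + 1)), ?_⟩
    rw [derivative_monomial]
    have : (n : ℂ) + 1 ≠ 0 := Nat.cast_add_one_ne_zero n
    simp [div_mul_cancel₀ _ this]

/-- Let `J = P(q) / q` and `G = -q J' / (J - r)`. Then the `n`-th Taylor coefficient of `G` is the
value at `r` of the `n`-th Faber polynomial `p` of `J`: both `(p(J) - p(r)) G / q`, being the
derivative of a polynomial in `J`, and `(p(J) - q⁻ⁿ) G / q`, being analytic, have residue `0` at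
`q = 0`. -/
lemma coeff_eq_eval_faber {P G h : ℂ → ℂ} {r : ℂ} {s : FormalMultilinearSeries ℂ ℂ ℂ}
    (hG : HasFPowerSeriesAt G s 0) (hG0 : G 0 = 1)
    (hJ : ∀ᶠ q in 𝓝[≠] 0, HasDerivAt (fun q => P q / q) (-(G q * (P q / q - r) / q)) q)
    {p : ℂ[X]} {n : ℕ} (hh : AnalyticAt ℂ h 0)
    (hp : ∀ q ≠ 0, p.eval (P q / q) = (q ^ n)⁻¹ + q * h q) : s.coeff n = p.eval r := by
  obtain ⟨g, hg, hgq⟩ := hG.exists_eq_sum_add (n + 1)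
  obtain ⟨g₁, hg₁, hgq₁⟩ := hG.exists_eq_sum_add 1
  have hs0 : s.coeff 0 = 1 := by rw [← hG0]; exact hG.coeff_zero _
  obtain ⟨Q, hQ⟩ := X_sub_C_dvd_sub_C_eval (p := p) (a := r)
  obtain ⟨S, hS⟩ := Q.exists_derivative_eq
  set k : ℂ → ℂ := fun q => (s.coeff n - p.eval r) + q * (g q + G q * h q - p.eval r * g₁ q)
  have hk : AnalyticAt ℂ k 0 := analyticAt_const.fun_add (analyticAt_id.fun_mul
    ((hg.fun_add (hG.analyticAt.fun_mul hh)).fun_sub (analyticAt_const.fun_mul hg₁)))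
  have hev := (eventually_nhdsWithin_iff.mp hJ).and hk.eventually_analyticAt
  obtain ⟨R, hR, hball⟩ := Metric.nhds_basis_closedBall.eventually_iff.mp hev
  have hcauchy : (∮ q in C(0, R), (q - 0)⁻¹ • k q) = (2 * Real.pi * I : ℂ) • k 0 :=
    circleIntegral_sub_center_inv_smul_of_differentiable_on_off_countable hR Set.countable_empty
      (fun q hq => (hball hq).2.continuousAt.continuousWithinAt)
      (fun q hq => (hball (Metric.ball_subset_closedBall hq.1)).2.differentiableAt)
  -- `k(q) / q` has a primitive away from `0`
  have hzero : (∮ q in C(0, R), (q - 0)⁻¹ • k q) = 0 := by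
    refine circleIntegral.integral_eq_zero_of_hasDerivWithinAt hR.le (f := fun q =>
      -S.eval (P q / q) - ∑ m ∈ Finset.range n,
        s.coeff m / ((m : ℤ) - n : ℤ) * q ^ ((m : ℤ) - n : ℤ)) fun q hq => ?_
    have hq0 : q ≠ 0 := by
      rintro rfl
      simp [hR.ne] at hq
    have h1 := (hball (Metric.sphere_subset_closedBall hq)).1 hq0
    have h2 := (HasDerivAt.comp (h := fun q => P q / q) q (S.hasDerivAt (P q / q)) h1).neg
    have h3 : ∀ m ∈ Finset.range n, HasDerivAt
        (fun q : ℂ => s.coeff m / ((m : ℤ) - n : ℤ) * q ^ ((m : ℤ) - n : ℤ))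
        (s.coeff m * q ^ m / q ^ (n + 1)) q := by
      intro m hm
      have hm' := Finset.mem_range.mp hm
      refine ((hasDerivAt_zpow _ q (Or.inl hq0)).const_mul _).congr_deriv ?_
      have hne : (((m : ℤ) - n : ℤ) : ℂ) ≠ 0 := by
        rw [Int.cast_ne_zero]; lia
      have h4 : q ^ ((m : ℤ) - n - 1 : ℤ) = q ^ m / q ^ (n + 1) := by
        rw [← zpow_natCast, ← zpow_natCast, ← zpow_sub₀ hq0]
        congr 1
        push_cast
        ring
      rw [h4]
      field_simp
    refine (h2.sub (HasDerivAt.fun_sum h3)).hasDerivWithinAt.congr_deriv ?_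
    have e1 := hgq q
    have e2 := hgq₁ q
    have e3 := hp q hq0
    have e4 : p.eval (P q / q) - p.eval r = (P q / q - r) * Q.eval (P q / q) := by
      have := congrArg (Polynomial.eval (P q / q)) hQ
      simpa using this
    rw [Finset.sum_range_succ] at e1
    simp only [Finset.range_one, Finset.sum_singleton, hs0] at e2
    rw [hS, ← Finset.sum_div, sub_zero, smul_eq_mul]
    have e5 : -(Q.eval (P q / q) * -(G q * (P q / q - r) / q)) =
        G q * (p.eval (P q / q) - p.eval r) / q := by rw [e4]; ring
    rw [e5, e3]
    have e6 : ∑ m ∈ Finset.range n, s.coeff m * q ^ m =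
      G q - s.coeff n * q ^ n - q ^ (n + 1) * g q := by rw [e1]; ring
    rw [e6]
    simp only [k]
    field_simp
    rw [pow_succ]
    linear_combination (-p.eval r * q ^ (2 * n + 1)) * e2
  rw [hcauchy] at hzero
  have h0 : k 0 = 0 := (smul_eq_zero.mp hzero).resolve_left two_pi_I_ne_zero
  simpa [k, sub_eq_zero] using h0

end Faber

/-! ### The functions `j_n` and their generating function -/

section GeneratingFunction

open Polynomial Derivative ModularForm Function.Periodic

lemma exists_qParam_eq {q : ℂ} (h0 : q ≠ 0) (h1 : ‖q‖ < 1) : ∃ z : ℍ, qParam 1 (z : ℂ) = q := by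
  have hq := qParam_right_inv one_ne_zero h0
  exact ⟨⟨invQParam 1 q, by rw [← norm_qParam_lt_iff one_pos, hq]; simpa using h1⟩, hq⟩

/-- The function `q j`, as a function of `q`. -/
noncomputable def jNum (q : ℂ) : ℂ := cuspFunction 1 E₄ q ^ 3 / discUnit q

/-- The function `-D j / (j - r) = E₄² E₆ / (E₄³ - r Δ)`, as a function of `q`. -/
noncomputable def faberGen (r q : ℂ) : ℂ :=
  cuspFunction 1 E₄ q ^ 2 * cuspFunction 1 E₆ q / (cuspFunction 1 E₄ q ^ 3 - r * (q * discUnit q))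

lemma jNum_zero : jNum 0 = 1 := by simp [jNum, cuspFunction_E₄_zero, discUnit_zero]

lemma analyticAt_jNum : AnalyticAt ℂ jNum 0 :=
  (analyticAt_cuspFunction_E₄.pow 3).div analyticAt_discUnit (by simp [discUnit_zero])

lemma jInv_eq_jNum_div (z : ℍ) : jInv z = jNum (qParam 1 (z : ℂ)) / qParam 1 (z : ℂ) := by
  rw [jInv, jNum, cuspFunction_qParam, discriminant_eq_qParam_mul, div_div, mul_comm]

lemma faberGen_zero (r : ℂ) : faberGen r 0 = 1 := by
  simp [faberGen, cuspFunction_E₄_zero, cuspFunction_E₆_zero]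

lemma analyticAt_faberGen (r : ℂ) : AnalyticAt ℂ (faberGen r) 0 := by
  refine ((analyticAt_cuspFunction_E₄.pow 2).mul analyticAt_cuspFunction_E₆).div
    ((analyticAt_cuspFunction_E₄.pow 3).sub
      (analyticAt_const.mul (analyticAt_id.mul analyticAt_discUnit))) ?_
  simp [cuspFunction_E₄_zero]

lemma faberGen_qParam (r : ℂ) (z : ℍ) : faberGen r (qParam 1 (z : ℂ)) =
    E₄ z ^ 2 * E₆ z / (E₄ z ^ 3 - r * discriminant z) := by
  rw [faberGen, cuspFunction_qParam, cuspFunction_qParam, discriminant_eq_qParam_mul]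

lemma sub_mul_discriminant_ne_zero {r : ℂ} {z : ℍ} (h : jInv z ≠ r) :
    E₄ z ^ 3 - r * discriminant z ≠ 0 := by
  intro h0
  refine h ?_
  rw [jInv, div_eq_iff (discriminant_ne_zero z)]
  linear_combination h0

lemma hasDerivAt_jNum_div {r : ℂ} {z : ℍ} (h : jInv z ≠ r) :
    HasDerivAt (fun q => jNum q / q) (-(faberGen r (qParam 1 (z : ℂ)) *
      (jNum (qParam 1 (z : ℂ)) / qParam 1 (z : ℂ) - r) / qParam 1 (z : ℂ)))
      (qParam 1 (z : ℂ)) := by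
  set q := qParam 1 (z : ℂ)
  have hq0 : q ≠ 0 := qParam_ne_zero _
  have hq1 : ‖q‖ < 1 := norm_qParam_lt_one' z
  have hΔ := discriminant_ne_zero z
  have hu : discUnit q ≠ 0 := by
    rw [discriminant_eq_qParam_mul] at hΔ
    exact right_ne_zero_of_mul hΔ
  have hd : DifferentiableAt ℂ (fun q => jNum q / q) q :=
    (((differentiableAt_cuspFunction' E₄ hq1).pow 3).div (differentiableOn_discUnit.differentiableAt
      (Metric.isOpen_ball.mem_nhds (by simpa using hq1))) hu).fun_div differentiableAt_id hq0
  have hcomp := HasDerivAt.comp (h := qParam 1) (z : ℂ) hd.hasDerivAt (hasDerivAt_qParam z)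
  have hev : jInv ∘ ofComplex =ᶠ[𝓝 (z : ℂ)] (fun q => jNum q / q) ∘ qParam 1 := by
    filter_upwards [isOpen_upperHalfPlaneSet.mem_nhds z.coe_im_pos] with w hw
    simpa [ofComplex_apply_of_im_pos hw] using jInv_eq_jNum_div ⟨w, hw⟩
  have h1 := deriv_jInv z
  rw [hev.deriv_eq, hcomp.deriv] at h1
  refine hd.hasDerivAt.congr_deriv ?_
  have h2 : deriv (fun q => jNum q / q) q = -(E₄ z ^ 2 * E₆ z / discriminant z) / q := by
    rw [eq_div_iff hq0]
    refine mul_left_cancel₀ two_pi_I_ne_zero ?_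
    linear_combination h1
  rw [h2, ← jInv_eq_jNum_div, faberGen_qParam, jInv]
  have hne : E₄ z ^ 3 - discriminant z * r ≠ 0 := by
    rw [mul_comm]
    exact sub_mul_discriminant_ne_zero h
  field_simp

lemma eventually_hasDerivAt_jNum_div (r : ℂ) : ∀ᶠ q in 𝓝[≠] 0,
    HasDerivAt (fun q => jNum q / q) (-(faberGen r q * (jNum q / q - r) / q)) q := by
  have hc : ContinuousAt (fun q => cuspFunction 1 E₄ q ^ 3 - r * (q * discUnit q)) 0 :=
    (analyticAt_cuspFunction_E₄.continuousAt.pow 3).sub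
      (continuousAt_const.mul (continuousAt_id.mul analyticAt_discUnit.continuousAt))
  rw [eventually_nhdsWithin_iff]
  filter_upwards [hc.eventually_ne (y := 0) (by simp [cuspFunction_E₄_zero]),
    Metric.ball_mem_nhds (0 : ℂ) one_pos] with q hq hq1 hq0
  obtain ⟨z, rfl⟩ := exists_qParam_eq hq0 (by simpa using hq1)
  refine hasDerivAt_jNum_div fun h => hq ?_
  rw [cuspFunction_qParam, ← discriminant_eq_qParam_mul, ← h, jInv,
    div_mul_cancel₀ _ (discriminant_ne_zero z), sub_self]

/-- The Faber polynomials of `j`, characterised by `pₙ(j) = q⁻ⁿ + O(q)`. -/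
noncomputable def faberPoly (n : ℕ) : ℂ[X] := (exists_faber analyticAt_jNum jNum_zero n).choose

lemma faberPoly_spec (n : ℕ) : ∃ h : ℂ → ℂ, AnalyticAt ℂ h 0 ∧
    ∀ q ≠ 0, (faberPoly n).eval (jNum q / q) = (q ^ n)⁻¹ + q * h q :=
  (exists_faber analyticAt_jNum jNum_zero n).choose_spec

/-- The generating function of the Faber polynomials:
`∑ pₙ(r) qⁿ = -D j / (j - r)` for small `q`. -/
lemma eventually_hasSum_faberGen (r : ℂ) :
    ∀ᶠ q in 𝓝 0, HasSum (fun n => (faberPoly n).eval r * q ^ n) (faberGen r q) := by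
  obtain ⟨s, hs⟩ := analyticAt_faberGen r
  filter_upwards [hs.eventually_hasSum] with q hq
  rw [zero_add] at hq
  refine hq.congr_fun fun n => ?_
  obtain ⟨h, hh, hp⟩ := faberPoly_spec n
  rw [← coeff_eq_eval_faber hs (faberGen_zero r) (eventually_hasDerivAt_jNum_div r) hh hp,
    FormalMultilinearSeries.apply_eq_pow_smul_coeff, smul_eq_mul, mul_comm]

lemma isJ_faberPoly (n : ℕ) : IsJ n (fun z => (faberPoly n).eval (jInv z)) where
  slash_eq γ := by
    ext z
    rw [SL_slash_apply, jInv_smul]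
    simp
  holo := by
    rw [UpperHalfPlane.mdifferentiable_iff]
    exact (faberPoly n).differentiable.comp_differentiableOn
      (UpperHalfPlane.mdifferentiable_iff.mp mdifferentiable_jInv)
  expansion := by
    obtain ⟨h, hh, hp⟩ := faberPoly_spec n
    have hb : (fun z : ℍ => h (qParam 1 (z : ℂ))) =O[atImInfty] (fun _ => (1 : ℝ)) :=
      (hh.continuousAt.tendsto.comp (qParam_tendsto_atImInfty one_pos)).isBigO_one ℝ
    have h1 : (fun z : ℍ => nome z * h (qParam 1 (z : ℂ))) =O[atImInfty] nome := by
      simpa using (isBigO_refl nome atImInfty).mul (hb.trans (isBigO_const_const (1 : ℝ)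
        (one_ne_zero : (1 : ℂ) ≠ 0) _))
    refine h1.congr_left fun z => ?_
    rw [jInv_eq_jNum_div, hp _ (qParam_ne_zero _), nome_eq, inv_pow]
    ring

/-- The difference of two functions with the properties of `j_n` is a modular form of weight `0`
vanishing at `i∞`. -/
lemma IsJ.eq {n : ℕ} {F F' : ℍ → ℂ} (h : IsJ n F) (h' : IsJ n F') : F = F' := by
  have hO : (F - F') =O[atImInfty] nome := by
    refine (h.expansion.sub h'.expansion).congr_left fun z => ?_
    simp
  have hlim : Tendsto (F - F') atImInfty (𝓝 0) := by
    refine hO.trans_tendsto ?_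
    exact (qParam_tendsto_atImInfty one_pos).congr fun z => (nome_eq z).symm
  have hslash : ∀ γ : SL(2, ℤ), (F - F') ∣[(0 : ℤ)] γ = F - F' := fun γ => by
    rw [sub_eq_add_neg, SlashAction.add_slash, SlashAction.neg_slash, h.slash_eq, h'.slash_eq]
  let f : ModularForm 𝒮ℒ 0 :=
    levelOneForm (F - F') hslash (h.holo.sub h'.holo) (hlim.isBigO_one ℝ)
  obtain ⟨c, hc⟩ := ModularFormClass.levelOne_weight_zero_const f
  have hc' : F - F' = Function.const _ c := hc
  rw [hc'] at hlim
  have hc0 : c = 0 := tendsto_nhds_unique tendsto_const_nhds hlim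
  ext z
  have := congrFun hc' z
  rwa [hc0, Pi.sub_apply, Function.const_apply, sub_eq_zero] at this

lemma jn_eq (n : ℕ) (z : ℍ) : jn n z = (faberPoly n).eval (jInv z) :=
  congrFun ((Classical.epsilon_spec ⟨_, isJ_faberPoly n⟩ : IsJ n (jn n)).eq (isJ_faberPoly n)) z

/-! ### The function `H_z` -/

/-- `-D j / (j - r)` as a meromorphic function on the upper half-plane. -/
noncomputable def polarPart (r : ℂ) : ℂ → ℂ :=
  (fun z : ℍ => E₄ z ^ 2 * E₆ z / (E₄ z ^ 3 - r * discriminant z)) ∘ ofComplex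

lemma analyticAt_polarPart_num (z : ℍ) :
    AnalyticAt ℂ (fun w => (E₄ ∘ ofComplex) w ^ 2 * (E₆ ∘ ofComplex) w) z :=
  ((analyticAt_comp_ofComplex (ModularFormClass.holo E₄) z).fun_pow 2).fun_mul
    (analyticAt_comp_ofComplex (ModularFormClass.holo E₆) z)

lemma analyticAt_polarPart_den (r : ℂ) (z : ℍ) : AnalyticAt ℂ
    (fun w => (E₄ ∘ ofComplex) w ^ 3 - r * (discriminant ∘ ofComplex) w) z :=
  ((analyticAt_comp_ofComplex (ModularFormClass.holo E₄) z).fun_pow 3).fun_sub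
    (analyticAt_const.fun_mul (analyticAt_comp_ofComplex mdifferentiable_discriminant z))

lemma meromorphicOn_polarPart (r : ℂ) : MeromorphicOn (polarPart r) upperHalfPlaneSet := fun w hw =>
  (analyticAt_polarPart_num ⟨w, hw⟩).meromorphicAt.fun_div
    (analyticAt_polarPart_den r ⟨w, hw⟩).meromorphicAt

lemma toMeromorphicNFOn_polarPart {r : ℂ} {z : ℍ} (h : jInv z ≠ r) :
    toMeromorphicNFOn (polarPart r) upperHalfPlaneSet z =
      E₄ z ^ 2 * E₆ z / (E₄ z ^ 3 - r * discriminant z) := by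
  have han : AnalyticAt ℂ (polarPart r) z :=
    (analyticAt_polarPart_num z).fun_div (analyticAt_polarPart_den r z)
      (by simpa using sub_mul_discriminant_ne_zero h)
  rw [toMeromorphicNFOn_eq_toMeromorphicNFAt (meromorphicOn_polarPart r) z.coe_im_pos,
    toMeromorphicNFAt_eq_self.mpr han.meromorphicNFAt]
  simp [polarPart]

lemma eventually_jInv_ne (r : ℂ) : ∀ᶠ z in atImInfty, jInv z ≠ r := by
  filter_upwards [tendsto_norm_jInv.eventually (eventually_gt_atTop ‖r‖)] with z hz h
  rw [h] at hz
  exact lt_irrefl _ hz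

lemma isHz_polarPart (z : ℍ) :
    IsHz z (fun τ => toMeromorphicNFOn (polarPart (jInv z)) upperHalfPlaneSet τ) where
  mero := fun w hw => by
    have hev : (fun τ : ℍ => toMeromorphicNFOn (polarPart (jInv z)) upperHalfPlaneSet τ) ∘ ofComplex
        =ᶠ[𝓝 w] toMeromorphicNFOn (polarPart (jInv z)) upperHalfPlaneSet := by
      filter_upwards [isOpen_upperHalfPlaneSet.mem_nhds hw] with x hx
      simp [ofComplex_apply_of_im_pos hx]
    rw [meromorphicNFAt_congr hev]
    exact meromorphicNFOn_toMeromorphicNFOn _ _ hw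
  series := by
    filter_upwards [eventually_jInv_ne (jInv z),
      (qParam_tendsto_atImInfty one_pos).eventually (eventually_hasSum_faberGen (jInv z))]
      with τ h1 h2
    rw [toMeromorphicNFOn_polarPart h1, ← faberGen_qParam]
    simpa only [jn_eq, nome_eq] using h2

lemma IsHz.eq {z : ℍ} {H H' : ℍ → ℂ} (h : IsHz z H) (h' : IsHz z H') : H = H' := by
  have hsub : MeromorphicOn (H ∘ ofComplex - H' ∘ ofComplex) upperHalfPlaneSet :=
    h.mero.meromorphicOn.sub h'.mero.meromorphicOn
  have hev : ∀ᶠ τ in atImInfty, H τ = H' τ := by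
    filter_upwards [h.series, h'.series] with τ h1 h2 using h1.unique h2
  obtain ⟨A, hA⟩ := (atImInfty_mem _).mp hev
  -- the two functions agree near a point high in the upper half-plane
  have hpos : 0 < max A 0 + 1 := by positivity
  let w : ℍ := ⟨(max A 0 + 1 : ℝ) * I, by simpa using hpos⟩
  have hw : w.im = max A 0 + 1 := by
    change ((max A 0 + 1 : ℝ) * I : ℂ).im = _
    simp
  have htop : meromorphicOrderAt (H ∘ ofComplex - H' ∘ ofComplex) w = ⊤ := by
    rw [meromorphicOrderAt_eq_top_iff]
    refine Eventually.filter_mono nhdsWithin_le_nhds ?_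
    have hopen : IsOpen {x : ℂ | max A 0 < x.im} := isOpen_lt continuous_const continuous_im
    filter_upwards [hopen.mem_nhds (show max A 0 < (w : ℂ).im by
      rw [coe_im, hw]; exact lt_add_one _)] with x hx
    have hx0 : 0 < x.im := lt_of_le_of_lt (le_max_right _ _) hx
    have := hA ⟨x, hx0⟩ ((le_max_left A 0).trans hx.le)
    simpa [ofComplex_apply_of_im_pos hx0, sub_eq_zero] using this
  ext τ
  have htop' : meromorphicOrderAt (H ∘ ofComplex - H' ∘ ofComplex) τ = ⊤ := by
    by_contra hne
    exact hsub.meromorphicOrderAt_ne_top_of_isPreconnected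
      (convex_halfSpace_im_gt 0).isPreconnected τ.coe_im_pos w.coe_im_pos hne htop
  have heq : H ∘ ofComplex =ᶠ[𝓝[≠] (τ : ℂ)] H' ∘ ofComplex := by
    filter_upwards [meromorphicOrderAt_eq_top_iff.mp htop'] with x hx
    exact sub_eq_zero.mp hx
  have := ((h.mero τ.coe_im_pos).eventuallyEq_nhdsNE_iff_eventuallyEq_nhds
    (h'.mero τ.coe_im_pos)).mp heq
  simpa using this.eq_of_nhds

/-- Away from the orbit of `z`, `H_z = -D j / (j - j(z))`. -/
lemma Hz_eq {z τ : ℍ} (h : jInv τ ≠ jInv z) :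
    Hz z τ = E₄ τ ^ 2 * E₆ τ / (E₄ τ ^ 3 - jInv z * discriminant τ) := by
  have h1 : IsHz z (Hz z) := Classical.epsilon_spec ⟨_, isHz_polarPart z⟩
  rw [h1.eq (isHz_polarPart z)]
  exact toMeromorphicNFOn_polarPart h

end GeneratingFunction

/-! ### The divisor modular form of a holomorphic modular form -/

section DivisorForm

open Polynomial Derivative ModularForm

lemma exists_modularForm_pow {k : ℤ} (f : ModularForm 𝒮ℒ k) (n : ℕ) :
    ∃ g : ModularForm 𝒮ℒ (n * k), ∀ z, g z = f z ^ n := by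
  induction n with
  | zero => exact ⟨ModularForm.mcast (by simp) (1 : ModularForm 𝒮ℒ 0), fun z => by
      rw [ModularForm.mcast_apply, pow_zero]; rfl⟩
  | succ n ih =>
    obtain ⟨g, hg⟩ := ih
    refine ⟨ModularForm.mcast (by push_cast; ring) (g.mul f), fun z => ?_⟩
    rw [ModularForm.mcast_apply, pow_succ, ← hg]
    rfl

/-- Modular forms of weight `12 n` are of the form `Δⁿ P(j)` with a polynomial `P`. -/
lemma exists_eq_discriminant_pow_mul (n : ℕ) (g : ModularForm 𝒮ℒ (12 * n)) :
    ∃ P : ℂ[X], ∀ z, g z = discriminant z ^ n * P.eval (jInv z) := by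
  induction n with
  | zero =>
    obtain ⟨c, hc⟩ := ModularFormClass.levelOne_weight_zero_const
      (ModularForm.mcast (by simp) g : ModularForm 𝒮ℒ 0)
    refine ⟨C c, fun z => ?_⟩
    rw [pow_zero, one_mul, eval_C]
    exact congrFun hc z
  | succ n ih =>
    -- subtract a multiple of `E₄ ^ (3 (n + 1))` and divide by `Δ`
    obtain ⟨M, hM⟩ := exists_modularForm_pow E₄ (3 * (n + 1))
    set c := (qExpansion 1 g).coeff 0
    set M' : ModularForm 𝒮ℒ (12 * (n + 1 : ℕ)) := ModularForm.mcast (by push_cast; ring) M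
    have hM' : ∀ z, M' z = E₄ z ^ (3 * (n + 1)) := hM
    have hcoeff : (qExpansion 1 (g - c • M')).coeff 0 = 0 := by
      refine tendsto_nhds_unique (tendsto_atImInfty_coeff_zero (g - c • M')) ?_
      have h1 := (tendsto_atImInfty_coeff_zero g).sub
        (((tendsto_E₄.pow (3 * (n + 1))).const_mul c))
      rw [one_pow, mul_one, sub_self] at h1
      refine h1.congr fun z => ?_
      rw [← hM']
      rfl
    obtain ⟨P, hP⟩ := ih (ModularForm.mcast (by push_cast; ring)
      (CuspForm.discriminantEquiv (toCuspForm (g - c • M') hcoeff)))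
    refine ⟨C c * X ^ (n + 1) + P, fun z => ?_⟩
    have h1 := hP z
    rw [ModularForm.mcast_apply, CuspForm.discriminantEquiv_apply, toCuspForm_apply,
      div_eq_iff (discriminant_ne_zero z)] at h1
    have h2 : (g - c • M') z = g z - c * E₄ z ^ (3 * (n + 1)) := by
      rw [← hM']; rfl
    have hΔ := discriminant_ne_zero z
    rw [h2] at h1
    simp only [eval_add, eval_mul, eval_C, eval_pow, eval_X]
    have h3 : E₄ z ^ (3 * (n + 1)) = discriminant z ^ (n + 1) * jInv z ^ (n + 1) := by
      rw [← mul_pow, jInv, mul_div_cancel₀ _ hΔ, pow_mul]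
    rw [h3] at h1
    linear_combination h1

variable {k : ℕ} {F : ModularForm 𝒮ℒ (2 * k)} {P : ℂ[X]}

lemma exists_pow_six_eq (F : ModularForm 𝒮ℒ (2 * k)) :
    ∃ P : ℂ[X], ∀ z, F z ^ 6 = discriminant z ^ k * P.eval (jInv z) := by
  obtain ⟨g, hg⟩ := exists_modularForm_pow F 6
  obtain ⟨P, hP⟩ := exists_eq_discriminant_pow_mul k (ModularForm.mcast (by push_cast; ring) g)
  exact ⟨P, fun z => by rw [← hg, ← hP]; rfl⟩

lemma ne_zero_of_pow_six_eq (hF : F ≠ 0) (hP : ∀ z, F z ^ 6 = discriminant z ^ k * P.eval (jInv z)) :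
    P ≠ 0 := by
  rintro rfl
  refine hF (DFunLike.ext _ _ fun z => ?_)
  have := hP z
  rw [eval_zero, mul_zero] at this
  simpa using this

/-- If `F ^ 6 = Δ ^ k P(j)`, then `6 ord_z F` is the multiplicity of the root `j(z)` of `P` times
the ramification index of `j` at `z`. -/
lemma ordAt_mul_six (hF : F ≠ 0) (hP : ∀ z, F z ^ 6 = discriminant z ^ k * P.eval (jInv z)) (z : ℍ) :
    (2 / (Nat.card (MulAction.stabilizer SL(2, ℤ) z) : ℂ)) * (ordAt F z : ℂ) =
      P.rootMultiplicity (jInv z) / 6 := by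
  obtain ⟨e, he, hcard, hord⟩ := exists_order_jInv_sub z
  have hP0 := ne_zero_of_pow_six_eq hF hP
  set m := P.rootMultiplicity (jInv z)
  obtain ⟨Q, hQ, hQr⟩ := exists_eq_pow_rootMultiplicity_mul_and_not_dvd P hP0 (jInv z)
  rw [dvd_iff_isRoot, IsRoot.def] at hQr
  have aF : AnalyticAt ℂ (F ∘ ofComplex) z := analyticAt_comp_ofComplex (ModularFormClass.holo F) z
  have aΔ : AnalyticAt ℂ (discriminant ∘ ofComplex) z :=
    analyticAt_comp_ofComplex mdifferentiable_discriminant z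
  have aj : AnalyticAt ℂ (jInv ∘ ofComplex) z := analyticAt_comp_ofComplex mdifferentiable_jInv z
  have aJ : AnalyticAt ℂ (fun w => (jInv ∘ ofComplex) w - jInv z) z := aj.sub analyticAt_const
  have aQ : AnalyticAt ℂ (fun w => Q.eval ((jInv ∘ ofComplex) w)) z :=
    (AnalyticAt.aeval_polynomial aj Q :)
  have heq : (F ∘ ofComplex) ^ 6 = (discriminant ∘ ofComplex) ^ k *
      ((fun w => (jInv ∘ ofComplex) w - jInv z) ^ m * fun w => Q.eval ((jInv ∘ ofComplex) w)) := by
    ext w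
    have h1 := hP (ofComplex w)
    rw [hQ] at h1
    simpa using h1
  have oΔ : meromorphicOrderAt (discriminant ∘ ofComplex) z = 0 :=
    aΔ.meromorphicNFAt.meromorphicOrderAt_eq_zero_iff.mpr (by simpa using discriminant_ne_zero z)
  have oQ : meromorphicOrderAt (fun w => Q.eval ((jInv ∘ ofComplex) w)) z = 0 :=
    aQ.meromorphicNFAt.meromorphicOrderAt_eq_zero_iff.mpr (by simpa using hQr)
  have h1 := congrArg (meromorphicOrderAt · (z : ℂ)) heq
  rw [meromorphicOrderAt_pow aF.meromorphicAt,
    meromorphicOrderAt_mul (aΔ.meromorphicAt.pow k) ((aJ.meromorphicAt.pow m).mul aQ.meromorphicAt),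
    meromorphicOrderAt_mul (aJ.meromorphicAt.pow m) aQ.meromorphicAt,
    meromorphicOrderAt_pow aΔ.meromorphicAt, meromorphicOrderAt_pow aJ.meromorphicAt, oΔ, oQ, hord,
    mul_zero, zero_add, add_zero] at h1
  have h2 : 6 * ordAt F z = m * e := by
    rw [ordAt]
    induction h : meromorphicOrderAt (F ∘ ofComplex) z using WithTop.recTopCoe with
    | top =>
      rw [h] at h1
      exfalso
      have h3 : ((m * e : ℤ) : WithTop ℤ) = ⊤ := by
        rw [WithTop.coe_mul, ← WithTop.mul_top (a := ((6 : ℕ) : WithTop ℤ)) (by norm_num)]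
        exact h1.symm
      exact WithTop.coe_ne_top h3
    | coe l =>
      rw [h] at h1
      exact WithTop.coe_injective
        ((WithTop.coe_mul 6 l).trans (h1.trans (WithTop.coe_mul (m : ℤ) (e : ℤ)).symm))
  have h3 : 6 * (ordAt F z : ℂ) = m * e := by exact_mod_cast h2
  have he' : (e : ℂ) ≠ 0 := by exact_mod_cast he.ne'
  rw [hcard]
  push_cast
  field_simp
  linear_combination h3

/-- The logarithmic derivative of `F ^ 6 = Δ ^ k P(j)`. -/
lemma normalizedDeriv_div_eq (hP : ∀ z, F z ^ 6 = discriminant z ^ k * P.eval (jInv z)) {z : ℍ}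
    (hz : F z ≠ 0) : 6 * (D F z / F z) = k * EisensteinSeries.E2 z -
      E₄ z ^ 2 * E₆ z / discriminant z * (P.derivative.eval (jInv z) / P.eval (jInv z)) := by
  have hΔ := discriminant_ne_zero z
  have hPz : P.eval (jInv z) ≠ 0 := by
    intro h
    have := hP z
    rw [h, mul_zero] at this
    exact hz (by simpa using this)
  have dF := (differentiableAt_comp_ofComplex (ModularFormClass.holo F) z).hasDerivAt
  have dΔ := (differentiableAt_comp_ofComplex mdifferentiable_discriminant z).hasDerivAt
  have dj := (differentiableAt_comp_ofComplex mdifferentiable_jInv z).hasDerivAt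
  have dP := HasDerivAt.comp (h := jInv ∘ ofComplex) (z : ℂ) (P.hasDerivAt _) dj
  have heq : (F ∘ ofComplex) ^ 6 = (discriminant ∘ ofComplex) ^ k *
      ((fun x => P.eval x) ∘ jInv ∘ ofComplex) := by
    ext w
    exact hP (ofComplex w)
  have h1 := (dF.pow 6).deriv
  rw [heq, ((dΔ.pow k).mul dP).deriv, deriv_jInv, deriv_discriminant_comp] at h1
  have eF : deriv (F ∘ ofComplex) z = 2 * Real.pi * I * D F z := by
    rw [normalizedDerivOfComplex, mul_inv_cancel_left₀ two_pi_I_ne_zero]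
  rw [eF] at h1
  simp only [Function.comp_apply, ofComplex_apply, Pi.pow_apply] at h1
  have hpow : (k : ℂ) * discriminant z ^ (k - 1) * discriminant z = k * discriminant z ^ k := by
    rcases k with _ | k
    · simp
    · rw [Nat.add_sub_cancel, pow_succ, mul_assoc]
  have h2 : 6 * F z ^ 5 * D F z = k * EisensteinSeries.E2 z * (discriminant z ^ k *
      P.eval (jInv z)) - discriminant z ^ k * P.derivative.eval (jInv z) *
        (E₄ z ^ 2 * E₆ z / discriminant z) := by
    refine mul_left_cancel₀ two_pi_I_ne_zero ?_
    push_cast at h1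
    linear_combination -h1 + 2 * Real.pi * I * EisensteinSeries.E2 z * P.eval (jInv z) * hpow
  have h3 : 6 * (D F z / F z) = 6 * F z ^ 5 * D F z / F z ^ 6 := by
    field_simp
  rw [h3, h2, hP]
  field_simp

/-- With `F ^ 6 = Δ ^ k P(j)`, the sum over orbits becomes a sum over the roots of `P`, in which it is
the partial fraction expansion of `P' / P`. -/
theorem divForm_eq (hF : F ≠ 0) {τ : ℍ} (hτ : F τ ≠ 0) :
    divForm F τ = k / 6 * EisensteinSeries.E2 τ - D F τ / F τ := by
  obtain ⟨P, hP⟩ := exists_pow_six_eq F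
  have hP0 := ne_zero_of_pow_six_eq hF hP
  have hPτ : P.eval (jInv τ) ≠ 0 := by
    intro h
    have := hP τ
    rw [h, mul_zero] at this
    exact hτ (by simpa using this)
  set A := E₄ τ ^ 2 * E₆ τ / discriminant τ
  set φ : ℂ → ℂ := fun r => P.roots.count r • (A / 6 * (1 / (jInv τ - r)))
  have hterm : ∀ p : MulAction.orbitRel.Quotient SL(2, ℤ) ℍ,
      (2 / (Nat.card (MulAction.stabilizer SL(2, ℤ) (Quotient.out p : ℍ)) : ℂ))
        * (ordAt F (Quotient.out p) : ℂ) * Hz (Quotient.out p) τ = φ (jQuot p) := by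
    intro p
    rw [ordAt_mul_six hF hP]
    simp only [φ, count_roots, jQuot]
    by_cases hroot : P.rootMultiplicity (jInv (Quotient.out p)) = 0
    · simp [hroot]
    · have hne : jInv τ ≠ jInv (Quotient.out p) := by
        intro h
        rw [← h] at hroot
        exact hPτ ((rootMultiplicity_pos hP0).mp (Nat.pos_of_ne_zero hroot))
      have hΔ := discriminant_ne_zero τ
      have hA : E₄ τ ^ 3 - jInv (Quotient.out p) * discriminant τ =
          (jInv τ - jInv (Quotient.out p)) * discriminant τ := by
        have hj : jInv τ * discriminant τ = E₄ τ ^ 3 := div_mul_cancel₀ _ hΔ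
        rw [sub_mul, hj]
      have hne' := sub_ne_zero.mpr hne
      rw [Hz_eq hne, hA, nsmul_eq_mul]
      simp only [A]
      field_simp
  have hsum : divForm F τ = A / 6 * (P.derivative.eval (jInv τ) / P.eval (jInv τ)) := by
    rw [divForm, finsum_eq_of_bijective jQuot bijective_jQuot hterm,
      finsum_eq_sum_of_support_subset (s := P.roots.toFinset),
      ← Finset.sum_multiset_map_count,
      (IsAlgClosed.splits P).eval_derivative_div_eval_of_ne_zero hPτ, Multiset.sum_map_mul_left]
    intro r hr
    simp only [φ, Function.mem_support] at hr
    rw [Finset.mem_coe, Multiset.mem_toFinset, ← Multiset.count_pos]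
    exact Nat.pos_of_ne_zero fun h => hr (by rw [h, zero_smul])
  rw [hsum]
  linear_combination (1 / 6) * normalizedDeriv_div_eq hP hτ

end DivisorForm

/-! ### The divisor modular form of `f_{k,D}` -/

section Zagier

open Derivative ModularForm

lemma E2_eq (z : ℍ) : E2 z = EisensteinSeries.E2 z := by
  rw [EisensteinSeries.E2_eq_tsum_cexp, E2]
  simp [ArithmeticFunction.sigma_one_apply, nome]

lemma firstCoeff_ne_zero {k : ℤ} {F : ModularForm 𝒮ℒ k} (hF : F ≠ 0) : firstCoeff F ≠ 0 := by
  refine PowerSeries.coeff_order ?_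
  rwa [ne_eq, ModularForm.qExpansion_eq_zero_iff one_pos one_mem_strictPeriods_SL]

lemma normalizedDeriv_smul {k : ℤ} (c : ℂ) (F : ModularForm 𝒮ℒ k) (z : ℍ) :
    D (c • F : ModularForm 𝒮ℒ k) z = c * D F z := by
  have h : (c • F : ModularForm 𝒮ℒ k) ∘ ofComplex = fun w => c * (F ∘ ofComplex) w := rfl
  rw [normalizedDerivOfComplex, normalizedDerivOfComplex, h, deriv_const_mul_field]
  ring

lemma omega_div_add_E2star {k : ℕ} {d : ℤ} (hk : 3 < k) (hd : 0 < d) {z : ℍ} (hz : fkD k d z ≠ 0) :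
    (k : ℂ) / (2 * Real.pi) * (omega (k + 1) d z / fkD k d z) + (k : ℂ) / 6 * E2star z =
      k / 6 * EisensteinSeries.E2 z - D (fkD k d) z / fkD k d z := by
  have hk0 : (k : ℂ) ≠ 0 := by exact_mod_cast (by lia : k ≠ 0)
  have hπ : (Real.pi : ℂ) ≠ 0 := by exact_mod_cast Real.pi_ne_zero
  have hy : (z.im : ℂ) ≠ 0 := by exact_mod_cast z.im_pos.ne'
  rw [omega_eq hk hd, E2star, E2_eq]
  field_simp
  ring

end Zagier

end ZagierForms

open ZagierForms
theorem theorem1p1 (k : ℕ) (hk : 2 < k) (hk_even : Even k)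
    (D : ℤ) (hD : 0 < D) (hD_disc : D % 4 = 0 ∨ D % 4 = 1) :
    -- all series involved converge absolutely
    (∀ z : ℍ,
      Summable (fun Q : QD D => ‖((Q : IntQuadForm).geo z : ℂ) / (Q : IntQuadForm).eval z 1 ^ (k + 1)‖)
      ∧ Summable (fun Q : QD D => ‖1 / (Q : IntQuadForm).eval z 1 ^ k‖)
      ∧ Summable (fun Q : QD D =>
          ‖(Q : IntQuadForm).evalDeriv z / (Q : IntQuadForm).eval z 1 ^ (k + 1)‖))
    -- (i)
    ∧ IsWeakMaassForm (2 * k + 2) (2 * k) (omega (k + 1) D)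
    ∧ Tendsto (omega (k + 1) D) atImInfty (𝓝 0)
    -- (ii)
    ∧ (∀ z : ℍ, omega (k + 1) D z =
        -I * (∑' Q : QD D, (Q : IntQuadForm).evalDeriv z / (Q : IntQuadForm).eval z 1 ^ (k + 1))
          + 1 / (z.im : ℂ) * fkD k D z)
    ∧ MDifferentiable 𝓘(ℂ) 𝓘(ℂ) (fun z : ℍ =>
        -I * (∑' Q : QD D, (Q : IntQuadForm).evalDeriv z / (Q : IntQuadForm).eval z 1 ^ (k + 1)))
    ∧ (fkD k D ≠ 0 →
        ¬ MDifferentiable 𝓘(ℂ) 𝓘(ℂ) (fun z : ℍ => 1 / (z.im : ℂ) * fkD k D z))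
    -- (iii)
    ∧ (fkD k D ≠ 0 →
        firstCoeff (fkD k D) ≠ 0
        ∧ ∀ z : ℍ, fkD k D z ≠ 0 →
          divForm (fun w : ℍ => 1 / firstCoeff (fkD k D) * fkD k D w) z =
              (k : ℂ) / (2 * Real.pi) * (omega (k + 1) D z / fkD k D z) + (k : ℂ) / 6 * E2star z
          ∧ divForm (fkD k D) z =
              (k : ℂ) / (2 * Real.pi) * (omega (k + 1) D z / fkD k D z)
                + (k : ℂ) / 6 * E2star z) := by
  have hk3 : 3 < k := by
    obtain ⟨m, rfl⟩ := hk_even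
    lia
  -- the series of absolute values over `ℤ³` needs an exponent above `3`; an even `k > 2` has it
  refine ⟨fun z => ⟨summable_norm_geo_div hk3 hD z, ?_, summable_norm_evalDeriv_div hk3 hD z⟩,
    isWeakMaassForm_omega hk3 hD, tendsto_omega hk3 hD, omega_eq_tsum hk3 hD,
    mdifferentiable_tsum_evalDeriv hk3 hD,
    fun hne h => hne (eq_zero_of_mdifferentiable_div_im (mdifferentiable_fkD hk3 hD) h),
    fun hne => ?_⟩
  · exact summable_norm_inv_eval_pow hk3 hD z.im_pos
  · obtain ⟨F, hFf⟩ : ∃ F : ModularForm 𝒮ℒ (2 * k : ℤ), ⇑F = fkD k D := ⟨fForm hk3 hD, rfl⟩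
    have hF : F ≠ 0 := fun h => hne (by rw [← hFf, h]; rfl)
    have hc : firstCoeff (fkD k D) ≠ 0 := hFf ▸ firstCoeff_ne_zero hF
    refine ⟨hc, fun z hz => ?_⟩
    rw [omega_div_add_E2star hk3 hD hz]
    rw [← hFf] at hc hz ⊢
    refine ⟨?_, divForm_eq hF hz⟩
    have hc' : 1 / firstCoeff F ≠ 0 := one_div_ne_zero hc
    have h := divForm_eq (F := (1 / firstCoeff F) • F) (smul_ne_zero hc' hF) (τ := z)
      (mul_ne_zero hc' hz)
    have hval : ((1 / firstCoeff F) • F) z = 1 / firstCoeff F * F z := rfl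
    rw [normalizedDeriv_smul, hval, mul_div_mul_left _ _ hc'] at h
    exact h
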